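/- Let $(P,\omega)$ be a symplectic manifold of dimension $2m$. Write $\flat(X)=i(X)\omega=\omega(X,\cdot)$ for vectors $X$, let $\sharp=\flat^{-1}:T^*P\to TP$, and let $\Pi$ be the Poisson bivector of $\omega$, $\langle\beta\wedge\alpha,\Pi\rangle=\beta(\sharp\alpha)$. Pairings of forms and multivectors are normalized by $\langle\alpha_1\wedge\cdots\wedge\alpha_k,X_1\wedge\cdots\wedge X_k\rangle=\det(\alpha_i(X_j))$. Let $D:\Omega^1(P)\to\Gamma^\infty(TP\otimes T^*P)$, $D_\eta\alpha=\langle\eta,D\alpha\rangle$, be a contravariant derivative: it is $\mathbb R$-linear, $D_{f\eta}\alpha=f\,D_\eta\alpha$ and $D_\eta(f\alpha)=f\,D_\eta\alpha+((\sharp\eta)f)\,\alpha$ for smooth functions $f$ and 1-forms $\alpha,\eta$. Assume that $D$ is a Poisson connection, i.e. $(\sharp\alpha)\langle\beta\wedge\gamma,\Pi\rangle=\langle D_\alpha\beta\wedge\gamma,\Pi\rangle+\langle\beta\wedge D_\alpha\gamma,\Pi\rangle$ for all 1-forms $\alpha,\beta,\gamma$, and that its torsion vanishes, i.e. $D_\alpha\beta-D_\beta\alpha=[\alpha,\beta]_\Pi:=\mathcal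 L_{\sharp\alpha}\beta-\mathcal L_{\sharp\beta}\alpha+d\langle\alpha\wedge\beta,\Pi\rangle$ for all 1-forms $\alpha,\beta$. Extend $D$ to the $k$-vector fields $A$ (uniquely) by $$\langle\alpha_1\wedge\cdots\wedge\alpha_k,D_\eta A\rangle=(\sharp\eta)\langle\alpha_1\wedge\cdots\wedge\alpha_k,A\rangle-\sum_{i=1}^k\langle\alpha_1\wedge\cdots\wedge D_\eta\alpha_i\wedge\cdots\wedge\alpha_k,A\rangle .$$ Let $\mu=\omega^m/m!$ be the Liouville volume form, let $\mu^\flat(A)=i(A)\mu$, where $\langle i(A)\mu,B\rangle=\langle\mu,A\wedge B\rangle$; this is an isomorphism from $k$-vector fields to $(2m-k)$-forms, with inverse $\mu^\sharp$. For $1\le k\le 2m$ let $\mathfrak C_\mu^k=\mu^\sharp\circ d\circ\mu^\flat:\Gamma^\infty(\wedge^kTP)\to\Gamma^\infty(\wedge^{k-1}TP)$ be the $k$-th curl operator. For a 1-form $\eta$ let $i(\eta)A$ be the $(k-1)$-vector given by $\langle\tau,i(\eta)A\rangle=\langle\tau\wedge\eta,A\rangle$ for all $(k-1)$-forms $\tau$.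 Then for every open set $U\subseteq P$, every smooth local frame $e_1,\dots,e_{2m}$ of $TP$ on $U$ with dual coframe $\theta^1,\dots,\theta^{2m}$, and every smooth $k$-vector field $K$ on $P$, $$\mathfrak C_\mu^k(K)\big|_U=-\sum_{i=1}^{2m} i(\flat(e_i))\,D_{\theta^i}K .$$ -/

import Mathlib

open scoped Manifold ContDiff

noncomputable section

namespace SymplecticCurl

/-! ### Linear algebra at a point

For a real topological vector space `V`, a `k`-covector on `V` is a continuous alternating
`k`-form `V [⋀^Fin k]→L[ℝ] ℝ`. A `k`-vector `A` over a finite-dimensional `V` is identified with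
the alternating `k`-form `(α₁, …, α_k) ↦ ⟨α₁ ∧ ⋯ ∧ α_k, A⟩` on the dual space of `V`, where
`⟨α₁ ∧ ⋯ ∧ α_k, X₁ ∧ ⋯ ∧ X_k⟩ = det (α_i (X_j))`. -/

section Pointwise

variable {V : Type*}

theorem update_castAdd {k l : ℕ} (v : Fin (k + l) → V) (i₀ : Fin k) (z : V) :
    (fun i => Function.update v (Fin.castAdd l i₀) z (Fin.castAdd l i)) =
        Function.update (fun i => v (Fin.castAdd l i)) i₀ z ∧
      (fun j => Function.update v (Fin.castAdd l i₀) z (Fin.natAdd k j)) =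
        fun j => v (Fin.natAdd k j) := by
  refine ⟨Function.update_comp_eq_of_injective v (Fin.castAdd_injective k l) i₀ z, ?_⟩
  funext j
  exact Function.update_of_ne (by simp [Fin.ext_iff]; omega) _ _

theorem update_natAdd {k l : ℕ} (v : Fin (k + l) → V) (j₀ : Fin l) (z : V) :
    (fun j => Function.update v (Fin.natAdd k j₀) z (Fin.natAdd k j)) =
        Function.update (fun j => v (Fin.natAdd k j)) j₀ z ∧
      (fun i => Function.update v (Fin.natAdd k j₀) z (Fin.castAdd l i)) =
        fun i => v (Fin.castAdd l i) := by
  refine ⟨Function.update_comp_eq_of_injective v (Fin.natAdd_injective l k) j₀ z, ?_⟩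
  funext j
  exact Function.update_of_ne (by simp [Fin.ext_iff]; omega) _ _

theorem append_update {k p : ℕ} (u : Fin k → V) (Y : Fin p → V) (i : Fin p) (z : V) :
    Fin.append u (Function.update Y i z) =
      Function.update (Fin.append u Y) (Fin.natAdd k i) z := by
  funext a
  refine Fin.addCases (fun i₀ => ?_) (fun j₀ => ?_) a
  · rw [Fin.append_left, Function.update_of_ne (by simp [Fin.ext_iff]; omega), Fin.append_left]
  · by_cases hj : j₀ = i
    · subst hj; simp
    · simp [Function.update_of_ne, hj]

variable [AddCommGroup V] [Module ℝ V] [TopologicalSpace V]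

/-- The product `(v₁, …, v_{k+l}) ↦ α (v₁, …, v_k) * β (v_{k+1}, …, v_{k+l})`, before
antisymmetrization. -/
def tensor {k l : ℕ} (α : V [⋀^Fin k]→L[ℝ] ℝ) (β : V [⋀^Fin l]→L[ℝ] ℝ) :
    ContinuousMultilinearMap ℝ (fun _ : Fin (k + l) => V) ℝ where
  toFun v := α (fun i => v (Fin.castAdd l i)) * β (fun j => v (Fin.natAdd k j))
  map_update_add' := by
    intro inst v i x y
    obtain rfl : inst = instDecidableEqFin _ := Subsingleton.elim _ _
    refine Fin.addCases (fun i₀ => ?_) (fun j₀ => ?_) i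
    · simp only [(update_castAdd v i₀ _).1, (update_castAdd v i₀ _).2,
        ContinuousAlternatingMap.map_update_add, add_mul]
    · simp only [(update_natAdd v j₀ _).1, (update_natAdd v j₀ _).2,
        ContinuousAlternatingMap.map_update_add, mul_add]
  map_update_smul' := by
    intro inst v i c x
    obtain rfl : inst = instDecidableEqFin _ := Subsingleton.elim _ _
    refine Fin.addCases (fun i₀ => ?_) (fun j₀ => ?_) i
    · simp only [(update_castAdd v i₀ _).1, (update_castAdd v i₀ _).2,
        ContinuousAlternatingMap.map_update_smul, smul_eq_mul, mul_assoc]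
    · simp only [(update_natAdd v j₀ _).1, (update_natAdd v j₀ _).2,
        ContinuousAlternatingMap.map_update_smul, smul_eq_mul, mul_left_comm]
  cont := by
    refine Continuous.mul (α.cont.comp ?_) (β.cont.comp ?_) <;> fun_prop

/-- The exterior product, normalized by
`(α₁ ∧ ⋯ ∧ α_k) (v₁, …, v_k) = det (α_i (v_j))` for 1-forms. -/
def wedge {k l : ℕ} (α : V [⋀^Fin k]→L[ℝ] ℝ) (β : V [⋀^Fin l]→L[ℝ] ℝ) :
    V [⋀^Fin (k + l)]→L[ℝ] ℝ :=
  ((k.factorial * l.factorial : ℕ) : ℝ)⁻¹ • ContinuousMultilinearMap.alternatization (tensor α β)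

/-- The exterior power `Ω ∧ ⋯ ∧ Ω` (`j` factors) of a 2-form. -/
def wedgePow (Ω : V [⋀^Fin 2]→L[ℝ] ℝ) : (j : ℕ) → V [⋀^Fin (2 * j)]→L[ℝ] ℝ
  | 0 => ContinuousAlternatingMap.constOfIsEmpty ℝ V (Fin 0) 1
  | j + 1 => wedge (wedgePow Ω j) Ω

/-- The `p`-form `(Y₁, …, Y_p) ↦ η (u₁, …, u_k, Y₁, …, Y_p)`: the interior product of
the `n`-form `η`, `n = k + p`, by `u₁ ∧ ⋯ ∧ u_k`. -/
def plug {k p n : ℕ} (h : k + p = n) (η : V [⋀^Fin n]→L[ℝ] ℝ) (u : Fin k → V) :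
    V [⋀^Fin p]→L[ℝ] ℝ where
  toFun Y := η (Fin.append u Y ∘ Fin.cast h.symm)
  map_update_add' := by
    intro inst Y i x y
    obtain rfl : inst = instDecidableEqFin _ := Subsingleton.elim _ _
    subst h
    simp [append_update]
  map_update_smul' := by
    intro inst Y i c x
    obtain rfl : inst = instDecidableEqFin _ := Subsingleton.elim _ _
    subst h
    simp [append_update]
  map_eq_zero_of_eq' := by
    intro Y i j hij hne
    subst h
    refine η.map_eq_zero_of_eq _ (i := Fin.natAdd k i) (j := Fin.natAdd k j) ?_ ?_
    · simpa using hij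
    · simpa [Fin.ext_iff] using hne
  cont := by
    refine η.cont.comp (continuous_pi fun a => ?_)
    subst h
    refine Fin.addCases (fun i₀ => ?_) (fun j₀ => ?_) a
    · simpa using continuous_const
    · simpa using continuous_apply j₀

variable [IsTopologicalAddGroup V] [ContinuousSMul ℝ V]

/-- The interior product `i(v)Ω = Ω(v, ·)` of a 2-form by a vector, as a linear form. -/
def interior₂ (Ω : V [⋀^Fin 2]→L[ℝ] ℝ) : V →ₗ[ℝ] (V →L[ℝ] ℝ) where
  toFun v :=
    { toFun := fun w => Ω ![v, w]
      map_add' := fun x y => by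
        have h : ∀ z, Function.update ![v, 0] 1 z = ![v, z] := fun z => by
          ext i; fin_cases i <;> rfl
        simpa only [h] using Ω.map_update_add ![v, 0] 1 x y
      map_smul' := fun c x => by
        have h : ∀ z, Function.update ![v, 0] 1 z = ![v, z] := fun z => by
          ext i; fin_cases i <;> rfl
        simpa only [h, RingHom.id_apply] using Ω.map_update_smul ![v, 0] 1 c x
      cont := Ω.cont.comp (continuous_pi fun i => by
        fin_cases i
        · exact continuous_const
        · exact continuous_id) }
  map_add' x y := by
    ext w
    have h : ∀ z, Function.update ![0, w] 0 z = ![z, w] := fun z => by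
      ext i; fin_cases i <;> rfl
    have := Ω.map_update_add ![0, w] 0 x y
    simp only [h] at this
    exact this
  map_smul' c x := by
    ext w
    have h : ∀ z, Function.update ![0, w] 0 z = ![z, w] := fun z => by
      ext i; fin_cases i <;> rfl
    have := Ω.map_update_smul ![0, w] 0 c x
    simp only [h] at this
    exact this

/-- The interior product `i(A)η` of the `n`-form `η` by the `k`-vector `A`, `n = k + p`, which is
determined by `⟨i(A)η, B⟩ = ⟨η, A ∧ B⟩`. Here `e` is a basis of `V` and `θ` its dual basis, so that
`A = (1 / k!) ∑_I A(θ^{I₁}, …, θ^{I_k}) e_{I₁} ∧ ⋯ ∧ e_{I_k}`; the result does not depend on the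
basis. -/
def interiorMV {d k p n : ℕ} (h : k + p = n) (e : Fin d → V) (θ : Fin d → (V →L[ℝ] ℝ))
    (A : (V →L[ℝ] ℝ) [⋀^Fin k]→L[ℝ] ℝ) (η : V [⋀^Fin n]→L[ℝ] ℝ) : V [⋀^Fin p]→L[ℝ] ℝ :=
  (k.factorial : ℝ)⁻¹ • ∑ I : Fin k → Fin d, A (fun a => θ (I a)) • plug h η (fun a => e (I a))

/-- The interior product `i(η)A` of a `(k+1)`-vector `A` by a 1-form `η`, given by
`⟨τ, i(η)A⟩ = ⟨τ ∧ η, A⟩` for every `k`-form `τ`: the form `η` goes into the *last* slot. -/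
def contract {k : ℕ} (η : V →L[ℝ] ℝ) (A : (V →L[ℝ] ℝ) [⋀^Fin (k + 1)]→L[ℝ] ℝ) :
    (V →L[ℝ] ℝ) [⋀^Fin k]→L[ℝ] ℝ where
  toFun τ := A (Fin.snoc τ η)
  map_update_add' := by
    intro inst τ i x y
    obtain rfl : inst = instDecidableEqFin _ := Subsingleton.elim _ _
    simp [Fin.snoc_update]
  map_update_smul' := by
    intro inst τ i c x
    obtain rfl : inst = instDecidableEqFin _ := Subsingleton.elim _ _
    simp [Fin.snoc_update]
  map_eq_zero_of_eq' := by
    intro τ i j hij hne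
    refine A.map_eq_zero_of_eq _ (i := i.castSucc) (j := j.castSucc) ?_ ?_
    · simpa using hij
    · simpa using hne
  cont := by
    refine A.cont.comp (continuous_pi fun a => ?_)
    refine Fin.lastCases ?_ (fun i => ?_) a
    · simpa using continuous_const
    · simpa using continuous_apply i

end Pointwise

/-! ### Fields on a manifold -/

/-- The model space `ℝⁿ`. -/
abbrev Model (n : ℕ) : Type := EuclideanSpace ℝ (Fin n)

section Manifold

variable {n : ℕ} {P : Type*} [TopologicalSpace P] [ChartedSpace (Model n) P]

/-- The tangent space at `x`. -/
abbrev T (x : P) : Type := TangentSpace 𝓘(ℝ, Model n) x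

/-- The cotangent space at `x`. -/
abbrev CoT (x : P) : Type := T (n := n) x →L[ℝ] ℝ

variable (n P) in
/-- Not necessarily smooth differential `k`-forms. -/
abbrev Form (k : ℕ) : Type _ := (x : P) → (T (n := n) x) [⋀^Fin k]→L[ℝ] ℝ

variable (n P) in
/-- Not necessarily smooth 1-forms. -/
abbrev OneForm : Type _ := (x : P) → CoT (n := n) x

/-- `k`-vectors at `x`, that is, elements of `Λᵏ T_x P`. -/
abbrev MV (k : ℕ) (x : P) : Type := (CoT (n := n) x) [⋀^Fin k]→L[ℝ] ℝ

variable (n P) in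
/-- Not necessarily smooth `k`-vector fields. -/
abbrev MVField (k : ℕ) : Type _ := (x : P) → MV (n := n) k x

/-- The coordinate expression of a `k`-form in the chart `c`: its pullback by `c.symm`. -/
def coordForm {k : ℕ} (c : OpenPartialHomeomorph P (Model n)) (η : Form n P k) (y : Model n) :
    (Model n) [⋀^Fin k]→L[ℝ] ℝ :=
  (η (c.symm y)).compContinuousLinearMap
    (mfderiv 𝓘(ℝ, Model n) 𝓘(ℝ, Model n) c.symm y : Model n →L[ℝ] T (n := n) (c.symm y))

/-- Smooth differential forms. -/
def SmoothForm {k : ℕ} (η : Form n P k) : Prop :=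
  ∀ c ∈ atlas (Model n) P, ContDiffOn ℝ ∞ (coordForm c η) c.target

/-- The exterior derivative, computed in the preferred chart at each point. -/
def extD {k : ℕ} (η : Form n P k) : Form n P (k + 1) := fun x =>
  (extDeriv (coordForm (chartAt (Model n) x) η) (chartAt (Model n) x x)).compContinuousLinearMap
    (mfderiv 𝓘(ℝ, Model n) 𝓘(ℝ, Model n) (chartAt (Model n) x) x : T (n := n) x →L[ℝ] Model n)

/-- The coordinate expression of a `k`-vector field in the chart `c`: its pushforward by `c`. -/
def coordMV {k : ℕ} (c : OpenPartialHomeomorph P (Model n)) (A : MVField n P k) (y : Model n) :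
    (Model n →L[ℝ] ℝ) [⋀^Fin k]→L[ℝ] ℝ :=
  (A (c.symm y)).compContinuousLinearMap
    (ContinuousLinearMap.precomp ℝ
      (mfderiv 𝓘(ℝ, Model n) 𝓘(ℝ, Model n) c (c.symm y) : T (n := n) (c.symm y) →L[ℝ] Model n))

/-- Smooth multivector fields. -/
def SmoothMV {k : ℕ} (A : MVField n P k) : Prop :=
  ∀ c ∈ atlas (Model n) P, ContDiffOn ℝ ∞ (coordMV c A) c.target

/-- A 1-form as a `k`-form with `k = 1`. -/
def OneForm.toForm (α : OneForm n P) : Form n P 1 := fun x =>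
  ContinuousAlternatingMap.ofSubsingleton ℝ (T (n := n) x) ℝ 0 (α x)

/-- Smooth 1-forms. -/
def SmoothOneForm (α : OneForm n P) : Prop := SmoothForm (OneForm.toForm α)

/-- Smooth functions. -/
def SmoothFun (f : P → ℝ) : Prop := ContMDiff 𝓘(ℝ, Model n) 𝓘(ℝ, ℝ) ∞ f

/-- The differential of a function. -/
def dFun (f : P → ℝ) : OneForm n P := fun x =>
  (mfderiv 𝓘(ℝ, Model n) 𝓘(ℝ, ℝ) f x : T (n := n) x →L[ℝ] ℝ)

/-- The Lie derivative `L_X β = i(X) dβ + d(β(X))` of a 1-form. -/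
def lieDeriv (X : (x : P) → T (n := n) x) (β : OneForm n P) : OneForm n P := fun x =>
  interior₂ (extD (OneForm.toForm β) x) (X x) + dFun (fun z => β z (X z)) x

/-- The standard basis of the tangent space, in the preferred chart at `x`. -/
def stdVec (x : P) (i : Fin n) : T (n := n) x := (EuclideanSpace.single i (1 : ℝ) : Model n)

/-- The basis dual to `stdVec`. -/
def stdCovec (x : P) (i : Fin n) : CoT (n := n) x :=
  (EuclideanSpace.proj i : Model n →L[ℝ] ℝ)

/-- `μ♭ : A ↦ i(A)μ` at a point, from `k`-vectors to `p`-forms, `k + p = n`. -/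
def muFlat {k p : ℕ} (h : k + p = n) (μ : Form n P n) (x : P) (A : MV (n := n) k x) :
    (T (n := n) x) [⋀^Fin p]→L[ℝ] ℝ :=
  interiorMV h (stdVec x) (stdCovec x) A (μ x)

/-- `μ♯`, the inverse of the map `μ♭` (which is a bijection when `μ` is a volume form). -/
def muSharp {k p : ℕ} (h : k + p = n) (μ : Form n P n) (x : P)
    (η : (T (n := n) x) [⋀^Fin p]→L[ℝ] ℝ) : MV (n := n) k x :=
  Function.invFun (muFlat h μ x) η

/-- The curl operator `μ♯ ∘ d ∘ μ♭` from `(k+1)`-vector fields to `k`-vector fields. -/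
def curl {k p : ℕ} (h : k + 1 + p = n) (μ : Form n P n) (A : MVField n P (k + 1)) :
    MVField n P k := fun x =>
  muSharp (k := k) (p := p + 1) (by omega) μ x (extD (fun z => muFlat h μ z (A z)) x)

variable (n P) in
/-- Symplectic forms: closed nondegenerate smooth 2-forms. -/
structure SymplecticForm where
  /-- the 2-form -/
  form : Form n P 2
  smooth : SmoothForm form
  closed : ∀ x, extD form x = 0
  nondegenerate : ∀ x (v : T (n := n) x), (∀ w, form x ![v, w] = 0) → v = 0

namespace SymplecticForm

variable (Ω : SymplecticForm n P)

theorem interior_bijective (x : P) : Function.Bijective (interior₂ (Ω.form x)) := by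
  have hinj : Function.Injective (interior₂ (Ω.form x)) := by
    rw [← LinearMap.ker_eq_bot, LinearMap.ker_eq_bot']
    intro v hv
    exact Ω.nondegenerate x v fun w => DFunLike.congr_fun hv w
  refine ⟨hinj, ?_⟩
  have : FiniteDimensional ℝ (T (n := n) x) :=
    inferInstanceAs (FiniteDimensional ℝ (Model n))
  have : T2Space (T (n := n) x) := inferInstanceAs (T2Space (Model n))
  let L : (T (n := n) x →ₗ[ℝ] ℝ) ≃ₗ[ℝ] CoT (n := n) x := LinearMap.toContinuousLinearMap
  have : FiniteDimensional ℝ (CoT (n := n) x) := L.finiteDimensional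
  refine (LinearMap.injective_iff_surjective_of_finrank_eq_finrank ?_).1 hinj
  rw [← L.finrank_eq]
  exact (Subspace.dual_finrank_eq (K := ℝ) (V := T (n := n) x)).symm

/-- `♭ : TP → T*P`, `♭X = i(X)Ω`. -/
def flat (x : P) : T (n := n) x ≃ₗ[ℝ] CoT (n := n) x :=
  LinearEquiv.ofBijective (interior₂ (Ω.form x)) (Ω.interior_bijective x)

/-- `♯ : T*P → TP`, the inverse of `♭`. -/
def sharp (x : P) : CoT (n := n) x ≃ₗ[ℝ] T (n := n) x := (Ω.flat x).symm

/-- The Poisson bivector of `Ω`: `⟨α ∧ β, Π⟩ = α(♯β)`. -/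
def poisson (x : P) (α β : CoT (n := n) x) : ℝ := α (Ω.sharp x β)

/-- The bracket `[α, β]_Π = L_{♯α} β - L_{♯β} α + d⟨α ∧ β, Π⟩` of 1-forms. -/
def bracket (α β : OneForm n P) : OneForm n P := fun x =>
  lieDeriv (fun z => Ω.sharp z (α z)) β x - lieDeriv (fun z => Ω.sharp z (β z)) α x
    + dFun (fun z => Ω.poisson z (α z) (β z)) x

end SymplecticForm

/-- Contravariant derivatives on `(P, Π)`, `Π` the Poisson bivector of `Ω`. The section `Dα` of
`TP ⊗ T*P` is written at `x` as the linear map `ξ ↦ D_ξ α = ⟨ξ, Dα⟩` from `T*_x P` to itself. Only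
the values of `D` on smooth 1-forms matter. -/
structure ContravariantDerivative (Ω : SymplecticForm n P) where
  /-- the map `α ↦ Dα` -/
  toFun : OneForm n P → (x : P) → (CoT (n := n) x →ₗ[ℝ] CoT (n := n) x)
  add : ∀ α β : OneForm n P, SmoothOneForm α → SmoothOneForm β → ∀ x,
    toFun (fun z => α z + β z) x = toFun α x + toFun β x
  smul : ∀ (c : ℝ) (α : OneForm n P), SmoothOneForm α → ∀ x,
    toFun (fun z => c • α z) x = c • toFun α x
  leibniz : ∀ (f : P → ℝ) (α : OneForm n P), SmoothFun (n := n) f → SmoothOneForm α →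
    ∀ x (ξ : CoT (n := n) x),
      toFun (fun z => f z • α z) x ξ = f x • toFun α x ξ + dFun f x (Ω.sharp x ξ) • α x
  smooth : ∀ η α : OneForm n P, SmoothOneForm η → SmoothOneForm α →
    SmoothOneForm (fun x => toFun α x (η x))

namespace ContravariantDerivative

variable {Ω : SymplecticForm n P} (D : ContravariantDerivative Ω)

/-- `D` is a Poisson connection, `DΠ = 0`:
`(♯ξ)⟨β ∧ γ, Π⟩ = ⟨D_ξ β ∧ γ, Π⟩ + ⟨β ∧ D_ξ γ, Π⟩`. -/
def IsPoisson : Prop :=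
  ∀ β γ : OneForm n P, SmoothOneForm β → SmoothOneForm γ → ∀ x (ξ : CoT (n := n) x),
    dFun (fun z => Ω.poisson z (β z) (γ z)) x (Ω.sharp x ξ) =
      Ω.poisson x (D.toFun β x ξ) (γ x) + Ω.poisson x (β x) (D.toFun γ x ξ)

/-- The torsion `D_α β - D_β α - [α, β]_Π` of `D` vanishes. -/
def IsTorsionFree : Prop :=
  ∀ α β : OneForm n P, SmoothOneForm α → SmoothOneForm β → ∀ x,
    D.toFun β x (α x) - D.toFun α x (β x) - Ω.bracket α β x = 0

/-- `B` is the contravariant derivative `DA` of the `a`-vector field `A`, as a section of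
`TP ⊗ Λᵃ TP`:
`⟨α₁ ∧ ⋯ ∧ α_a, D_ξ A⟩ = (♯ξ)⟨α₁ ∧ ⋯ ∧ α_a, A⟩ - ∑_i ⟨α₁ ∧ ⋯ ∧ D_ξ α_i ∧ ⋯ ∧ α_a, A⟩`
for all smooth 1-forms `α_i`. -/
def IsExtension {a : ℕ} (A : MVField n P a)
    (B : (x : P) → (CoT (n := n) x →ₗ[ℝ] MV (n := n) a x)) : Prop :=
  ∀ α : Fin a → OneForm n P, (∀ i, SmoothOneForm (α i)) → ∀ x (ξ : CoT (n := n) x),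
    B x ξ (fun i => α i x) =
      dFun (fun z => A z (fun i => α i z)) x (Ω.sharp x ξ)
        - ∑ i, A x (Function.update (fun j => α j x) i (D.toFun (α i) x ξ))

/-- The contravariant derivative `DA` of a multivector field: the section characterized by
`IsExtension`. -/
def onMV {a : ℕ} (A : MVField n P a) : (x : P) → (CoT (n := n) x →ₗ[ℝ] MV (n := n) a x) :=
  Classical.epsilon (D.IsExtension A)

end ContravariantDerivative

end Manifold

section Liouville

variable {m : ℕ} {P : Type*} [TopologicalSpace P] [ChartedSpace (Model (2 * m)) P]

/-- The Liouville volume form `Ωᵐ / m!`. -/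
def SymplecticForm.liouville (Ω : SymplecticForm (2 * m) P) : Form (2 * m) P (2 * m) := fun x =>
  (m.factorial : ℝ)⁻¹ • wedgePow (Ω.form x) m

end Liouville

end SymplecticCurl

end

/-! The connection `D` is a covariant derivative in disguise. Fix a point `x` and work in the
preferred chart at `x`, whose derivative at `x` is the identity. By the Leibniz rule, `D_{♭Z} α =
∂_Z α + Γ(Z, α)` at `x`, with `Γ` bilinear. Define `C_Z X` by `♭(C_Z X) = D_{♭Z}(♭X)` for vector
fields `X`, `Z` that are constant in the chart. The bracket `[♭X, ♭Y]_Π` at `x` is `dω(X, Y, ·) =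
0`, so vanishing torsion says exactly that `C` is symmetric; the Poisson condition says that `∂_X ω
= ω(C_X ·, ·) + ω(·, C_X ·)`. Together these give `Γ(Z, α) = -α ∘ C_Z`. Hence `D_{♭Z} = ∇_Z` at `x`
for a torsion-free connection with Christoffel symbols `C` that makes `ω`, and therefore `μ`,
parallel (`exists_christoffel`, `fderiv_wedgePow`).

For such a connection the curl is a divergence. The derivative of `i(A)μ` along `X` is `i(∇_X A)μ`
plus the action of `C_X` on the form `i(A)μ`. The exterior derivative alternates over all slots, and
the second term then vanishes because `C` is symmetric. What remains is `∑ θ^j ∧ i(∇_{b_j} A)μ`,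
which equals `i(∑ i(θ^j) ∇_{b_j} A)μ` because `θ^j ∧ μ = 0` in degree above the dimension
(`sum_interiorMV_removeNth`, `extDeriv_interiorMV`). Since `μ♭` is injective, the curl is `∑ i(θ^j)
∇_{b_j} A`.

It remains to rewrite this divergence with `♭e_i` and `♯θ^i` in place of `θ^j` and `b_j`; skewness
of `ω` produces the minus sign (`sum_contract_dual`). The operators `μ♯` and `D` on multivectors are
introduced by choice, so one also needs that `μ♭` is bijective, which rests on `ω^m ≠ 0`, and that
the extension of `D` exists and is unique. -/

open scoped Topology Manifold ContDiff

noncomputable section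
namespace SymplecticCurl

/-! ### Dual bases and naturality of the interior product -/

section MultilinearAlgebra

variable {V W : Type*} [NormedAddCommGroup V] [NormedSpace ℝ V]
  [NormedAddCommGroup W] [NormedSpace ℝ W]

theorem exists_basis_of_dual [FiniteDimensional ℝ V] {d : ℕ}
    (hd : Module.finrank ℝ V = d) {e : Fin d → V} {θ : Fin d → V →L[ℝ] ℝ} (hθ : ∀ i j, θ i (e j) = if i = j then 1 else 0) :
    ∃ b : Module.Basis (Fin d) ℝ V, ∀ i, b i = e i := by
  have hli : LinearIndependent ℝ e := by
    rw [Fintype.linearIndependent_iff]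
    intro g hg i
    have := congrArg (θ i) hg
    simpa [map_sum, hθ] using this
  exact ⟨Module.Basis.mk hli (hli.span_eq_top_of_card_eq_finrank' (by simp [hd])).ge,
    fun i => by simp⟩

section Dual

variable {ι : Type*} [Fintype ι] [DecidableEq ι] (b : Module.Basis ι ℝ V) {θ : ι → V →L[ℝ] ℝ}

theorem repr_eq_of_dual (hθ : ∀ i j, θ i (b j) = if i = j then 1 else 0) (i : ι) (v : V) :
    b.repr v i = θ i v := by
  conv_rhs => rw [← b.sum_repr v, map_sum]
  simp only [map_smul, hθ]
  simp

theorem sum_dual_smul (hθ : ∀ i j, θ i (b j) = if i = j then 1 else 0) (v : V) :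
    ∑ i, θ i v • b i = v := by
  simp_rw [← repr_eq_of_dual b hθ]
  exact b.sum_repr v

theorem sum_smul_dual (hθ : ∀ i j, θ i (b j) = if i = j then 1 else 0) (ξ : V →L[ℝ] ℝ) :
    ∑ i, ξ (b i) • θ i = ξ := by
  ext v
  conv_rhs => rw [← sum_dual_smul b hθ v]
  simp [map_sum, mul_comm]

/-- Both sides expand to the same double sum over the matrix entries `θ' (J a) (f a (b (I a)))`.
With equal `f a` this gives independence of the basis; a separate `f a` for each slot allows an
endomorphism to be moved in one slot only. -/
theorem sum_apply_mul_apply {κ : Type*} [Fintype κ] [DecidableEq κ] {k : ℕ}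
    (hθ : ∀ i j, θ i (b j) = if i = j then 1 else 0)
    (b' : Module.Basis κ ℝ W) {θ' : κ → W →L[ℝ] ℝ}
    (hθ' : ∀ i j, θ' i (b' j) = if i = j then 1 else 0)
    (A : MultilinearMap ℝ (fun _ : Fin k => V →L[ℝ] ℝ) ℝ)
    (B : MultilinearMap ℝ (fun _ : Fin k => W) ℝ) (f : Fin k → V →L[ℝ] W) :
    ∑ I : Fin k → ι, A (fun a => θ (I a)) * B (fun a => f a (b (I a))) =
      ∑ J : Fin k → κ, A (fun a => (θ' (J a)).comp (f a)) * B (fun a => b' (J a)) := by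
  have h1 : ∀ I : Fin k → ι, B (fun a => f a (b (I a))) =
      ∑ J : Fin k → κ, (∏ a, θ' (J a) (f a (b (I a)))) * B (fun a => b' (J a)) := fun I => by
    have : (fun a => f a (b (I a))) =
        fun a => ∑ j, θ' j (f a (b (I a))) • b' j := by
      funext a; rw [sum_dual_smul b' hθ']
    rw [this, MultilinearMap.map_sum]
    refine Finset.sum_congr rfl fun J _ => ?_
    rw [MultilinearMap.map_smul_univ, smul_eq_mul]
  have h2 : ∀ J : Fin k → κ, A (fun a => (θ' (J a)).comp (f a)) =
      ∑ I : Fin k → ι, (∏ a, θ' (J a) (f a (b (I a)))) * A (fun a => θ (I a)) := fun J => by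
    have : (fun a => (θ' (J a)).comp (f a)) =
        fun a => ∑ i, θ' (J a) (f a (b i)) • θ i := by
      funext a; exact (sum_smul_dual b hθ ((θ' (J a)).comp (f a))).symm
    rw [this, MultilinearMap.map_sum]
    refine Finset.sum_congr rfl fun I _ => ?_
    rw [MultilinearMap.map_smul_univ, smul_eq_mul]
  simp_rw [h1, h2, Finset.mul_sum, Finset.sum_mul]
  rw [Finset.sum_comm]
  refine Finset.sum_congr rfl fun J _ => Finset.sum_congr rfl fun I _ => by ring

end Dual

theorem append_update_left {X : Type*} {k p : ℕ} (u : Fin k → X) (Y : Fin p → X) (i : Fin k)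
    (z : X) :
    Fin.append (Function.update u i z) Y =
      Function.update (Fin.append u Y) (Fin.castAdd p i) z := by
  funext a
  refine Fin.addCases (fun i₀ => ?_) (fun j₀ => ?_) a
  · by_cases hj : i₀ = i
    · subst hj; simp
    · simp [Function.update_of_ne, hj]
  · rw [Fin.append_right, Function.update_of_ne (by simp [Fin.ext_iff]; omega), Fin.append_right]

/-- The alternating map `u ↦ η (u₁, …, u_k, Y₁, …, Y_p)`. -/
def plugLeft {k p n : ℕ} (h : k + p = n) (η : V [⋀^Fin n]→L[ℝ] ℝ) (Y : Fin p → V) :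
    V [⋀^Fin k]→ₗ[ℝ] ℝ where
  toFun u := η (Fin.append u Y ∘ Fin.cast h.symm)
  map_update_add' := by
    intro inst u i x y
    obtain rfl : inst = instDecidableEqFin _ := Subsingleton.elim _ _
    subst h
    simp [append_update_left]
  map_update_smul' := by
    intro inst u i c x
    obtain rfl : inst = instDecidableEqFin _ := Subsingleton.elim _ _
    subst h
    simp [append_update_left]
  map_eq_zero_of_eq' := by
    intro u i j hij hne
    subst h
    refine η.map_eq_zero_of_eq _ (i := Fin.castAdd p i) (j := Fin.castAdd p j) ?_ ?_
    · simpa using hij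
    · simpa [Fin.ext_iff] using hne

theorem plugLeft_apply {k p n : ℕ} (h : k + p = n) (η : V [⋀^Fin n]→L[ℝ] ℝ) (Y : Fin p → V)
    (u : Fin k → V) : plugLeft h η Y u = η (Fin.append u Y ∘ Fin.cast h.symm) := rfl

theorem plug_apply {k p n : ℕ} (h : k + p = n) (η : V [⋀^Fin n]→L[ℝ] ℝ) (Y : Fin p → V)
    (u : Fin k → V) : plug h η u Y = plugLeft h η Y u := rfl

theorem interiorMV_apply {d k p n : ℕ} (h : k + p = n) (e : Fin d → V) (θ : Fin d → (V →L[ℝ] ℝ))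
    (A : (V →L[ℝ] ℝ) [⋀^Fin k]→L[ℝ] ℝ) (η : V [⋀^Fin n]→L[ℝ] ℝ) (Y : Fin p → V) :
    interiorMV h e θ A η Y = (k.factorial : ℝ)⁻¹ *
      ∑ I : Fin k → Fin d, A (fun a => θ (I a)) * plugLeft h η Y (fun a => e (I a)) := by
  simp [interiorMV, plug_apply]

theorem interiorMV_comp {d k p n : ℕ} (h : k + p = n)
    (b : Module.Basis (Fin d) ℝ V) {θ : Fin d → V →L[ℝ] ℝ}
    (hθ : ∀ i j, θ i (b j) = if i = j then 1 else 0)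
    (b' : Module.Basis (Fin d) ℝ W) {θ' : Fin d → W →L[ℝ] ℝ}
    (hθ' : ∀ i j, θ' i (b' j) = if i = j then 1 else 0)
    (A : (V →L[ℝ] ℝ) [⋀^Fin k]→L[ℝ] ℝ) (η : V [⋀^Fin n]→L[ℝ] ℝ)
    (Φ : V →L[ℝ] W) (Ψ : W →L[ℝ] V) (hΨ : ∀ v, Ψ (Φ v) = v) :
    (interiorMV h b θ A η).compContinuousLinearMap Ψ =
      interiorMV h b' θ' (A.compContinuousLinearMap (ContinuousLinearMap.precomp ℝ Φ))
        (η.compContinuousLinearMap Ψ) := by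
  ext Y
  rw [ContinuousAlternatingMap.compContinuousLinearMap_apply, interiorMV_apply, interiorMV_apply]
  congr 1
  have key : ∀ u : Fin k → W, plugLeft h (η.compContinuousLinearMap Ψ) Y u =
      plugLeft h η (Ψ ∘ Y) (fun a => Ψ (u a)) := fun u => by
    subst h
    simp only [plugLeft_apply, ContinuousAlternatingMap.compContinuousLinearMap_apply]
    congr 1
    funext a
    refine Fin.addCases (fun i₀ => ?_) (fun j₀ => ?_) a <;> simp
  have := sum_apply_mul_apply b hθ b' hθ' A.toMultilinearMap
    (plugLeft h (η.compContinuousLinearMap Ψ) Y).toMultilinearMap (fun _ => Φ)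
  simp only [AlternatingMap.coe_multilinearMap] at this
  simp only [key] at this ⊢
  simp only [hΨ] at this
  exact this

end MultilinearAlgebra

/-! ### The interior product with a volume form is bijective -/

section InteriorBijective

variable {V W : Type*} [NormedAddCommGroup V] [NormedSpace ℝ V]
  [NormedAddCommGroup W] [NormedSpace ℝ W]

instance finiteDimensional_continuousAlternatingMap [FiniteDimensional ℝ V] (k : ℕ) :
    FiniteDimensional ℝ (V [⋀^Fin k]→L[ℝ] ℝ) := by
  let b := Module.finBasis ℝ V
  let ev : V [⋀^Fin k]→L[ℝ] ℝ →ₗ[ℝ] ((Fin k → Fin (Module.finrank ℝ V)) → ℝ) :=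
    { toFun := fun A I => A fun a => b (I a)
      map_add' := fun _ _ => rfl
      map_smul' := fun _ _ => rfl }
  refine FiniteDimensional.of_injective ev fun A B hAB => ?_
  refine ContinuousAlternatingMap.toAlternatingMap_injective (b.ext_alternating fun I _ => ?_)
  exact congrFun hAB I

/-- The map `A ↦ ∑_I A (w_{I₁}, …, w_{I_k}) i(e_{I₁} ∧ ⋯ ∧ e_{I_k}) η`. -/
def interiorAux {ι : Type*} [Fintype ι] {k p n : ℕ} (h : k + p = n) (e : ι → V) (w : ι → W)
    (η : V [⋀^Fin n]→L[ℝ] ℝ) : W [⋀^Fin k]→L[ℝ] ℝ →ₗ[ℝ] V [⋀^Fin p]→L[ℝ] ℝ where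
  toFun A := ∑ I : Fin k → ι, A (fun a => w (I a)) • plug h η (fun a => e (I a))
  map_add' A B := by simp [add_smul, Finset.sum_add_distrib]
  map_smul' c A := by simp [mul_smul, Finset.smul_sum]

theorem interiorAux_apply {ι : Type*} [Fintype ι] {k p n : ℕ} (h : k + p = n) (e : ι → V)
    (w : ι → W) (η : V [⋀^Fin n]→L[ℝ] ℝ) (A : W [⋀^Fin k]→L[ℝ] ℝ) (Y : Fin p → V) :
    interiorAux h e w η A Y =
      ∑ I : Fin k → ι, A (fun a => w (I a)) * plugLeft h η Y (fun a => e (I a)) := by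
  simp [interiorAux, plug_apply]

theorem exists_append_bijective {k p n : ℕ} (h : k + p = n) {I : Fin k → Fin n}
    (hI : Function.Injective I) :
    ∃ J : Fin p → Fin n, Function.Bijective (Fin.append I J ∘ Fin.cast h.symm) ∧
      ∀ x, (∀ b, J b ≠ x) → ∃ a, I a = x := by
  let S : Finset (Fin n) := (Finset.univ.image I)ᶜ
  have hS : S.card = p := by
    rw [Finset.card_compl, Finset.card_image_of_injective _ hI]
    simp; omega
  let J : Fin p → Fin n := S.orderEmbOfFin hS
  have hJ : ∀ b a, J b ≠ I a := fun b a hba => by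
    have := S.orderEmbOfFin_mem hS b
    change J b ∈ S at this
    rw [hba] at this
    simp [S] at this
  refine ⟨J, ?_, fun x hx => ?_⟩
  · subst h
    refine Finite.injective_iff_bijective.1 ?_
    have : Function.Injective (Fin.append I J) := by
      rw [Fin.append_injective_iff]
      exact ⟨hI, (S.orderEmbOfFin hS).injective, fun a b hab => hJ b a hab.symm⟩
    simpa using this
  · by_contra hne
    push Not at hne
    have hx' : x ∈ S := by simpa [S] using hne
    have : x ∈ Set.range (S.orderEmbOfFin hS) := by
      rw [Finset.range_orderEmbOfFin]; exact hx'
    obtain ⟨b, hb⟩ := this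
    exact hx b hb

/-- To read off the coefficient of `A` at `I`, evaluate the image on the basis vectors complementary
to `I`. Only rearrangements of `I` survive, and each contributes the same amount, since the sign of
the rearrangement occurs in both factors. -/
theorem interiorAux_injective {k p n : ℕ} (h : k + p = n) (e : Module.Basis (Fin n) ℝ V)
    (w : Module.Basis (Fin n) ℝ W) {η : V [⋀^Fin n]→L[ℝ] ℝ} (hη : η ≠ 0) :
    Function.Injective (interiorAux (k := k) h e w η) := by
  rw [← LinearMap.ker_eq_bot, LinearMap.ker_eq_bot']
  intro A hA
  refine ContinuousAlternatingMap.toAlternatingMap_injective (w.ext_alternating fun I hI => ?_)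
  obtain ⟨J, hbij, hJ⟩ := exists_append_bijective h hI
  have hsum := DFunLike.congr_fun hA fun b => e (J b)
  rw [interiorAux_apply] at hsum
  change _ = (0 : ℝ) at hsum
  set X := A (fun a => w (I a)) * plugLeft h η (fun b => e (J b)) (fun a => e (I a)) with hX
  classical
  have hterm : ∀ I' : Fin k → Fin n,
      A (fun a => w (I' a)) * plugLeft h η (fun b => e (J b)) (fun a => e (I' a)) =
        (if ∃ σ : Equiv.Perm (Fin k), I' = I ∘ σ then 1 else 0) * X := fun I' => by
    split_ifs with hσ
    · obtain ⟨σ, rfl⟩ := hσ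
      have h1 := A.toAlternatingMap.map_perm (fun a => w (I a)) σ
      have h2 := (plugLeft h η (fun b => e (J b))).map_perm (fun a => e (I a)) σ
      simp only [Function.comp_def] at h1 h2
      change A _ = _ at h1
      change A (fun a => w (I (σ a))) * plugLeft h η _ (fun a => e (I (σ a))) = _
      rw [h1, h2, one_mul, hX]
      rcases Int.units_eq_one_or (Equiv.Perm.sign σ) with hs | hs <;> simp [hs]
    · rw [zero_mul]
      refine mul_eq_zero_of_right _ ?_
      rw [plugLeft_apply]
      refine η.toAlternatingMap.map_eq_zero_of_not_injective _ fun hinj => hσ ?_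
      have hinj' : Function.Injective (Fin.append I' J) := by
        subst h
        intro x y hxy
        refine hinj (a₁ := x) (a₂ := y) ?_
        have : ∀ z, (Fin.append (fun a => e (I' a)) fun b => e (J b)) z =
            e (Fin.append I' J z) := fun z => by
          refine Fin.addCases (fun i₀ => ?_) (fun j₀ => ?_) z <;> simp
        simp [this, hxy]
      rw [Fin.append_injective_iff] at hinj'
      obtain ⟨hI', -, hd⟩ := hinj'
      choose g hg using fun a => hJ (I' a) fun b hb => hd a b hb.symm
      have hginj : Function.Injective g := fun x y hxy => hI' (by rw [← hg, ← hg, hxy])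
      exact ⟨Equiv.ofBijective g (Finite.injective_iff_bijective.1 hginj), funext fun a => (hg a).symm⟩
  simp_rw [hterm] at hsum
  rw [← Finset.sum_mul] at hsum
  have hpos : (0 : ℝ) < ∑ I' : Fin k → Fin n,
      if ∃ σ : Equiv.Perm (Fin k), I' = I ∘ σ then (1 : ℝ) else 0 :=
    Finset.sum_pos' (fun _ _ => by split_ifs <;> norm_num)
      ⟨I, Finset.mem_univ _, by rw [if_pos ⟨1, rfl⟩]; norm_num⟩
  have hX0 : X = 0 := (mul_eq_zero.1 hsum).resolve_left hpos.ne'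
  -- The other factor is the value of `η` on a reordered basis, so it cannot vanish for a nonzero
  -- form of top degree.
  refine (mul_eq_zero.1 (hX ▸ hX0)).resolve_right fun h0 => hη ?_
  let τ := Equiv.ofBijective _ hbij
  have h3 : η.toAlternatingMap (e.reindex τ.symm) = 0 := by
    rw [plugLeft_apply] at h0
    convert h0 using 1
    change η _ = η _
    congr 1
    funext x
    subst h
    simp only [Module.Basis.reindex_apply, Equiv.symm_symm, τ, Equiv.ofBijective_apply]
    refine Fin.addCases (fun i₀ => ?_) (fun j₀ => ?_) x <;> simp
  exact ContinuousAlternatingMap.toAlternatingMap_injective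
    ((AlternatingMap.map_basis_eq_zero_iff _ _).1 h3)

/-- Injectivity in both directions, from `k`-vectors to `p`-forms and back, forces equal dimensions,
and then injective implies surjective. No dimension of an exterior power has to be computed. -/
theorem interiorMV_bijective [FiniteDimensional ℝ V] {k p n : ℕ} (h : k + p = n)
    (b : Module.Basis (Fin n) ℝ V) {θ : Fin n → V →L[ℝ] ℝ}
    (hθ : ∀ i j, θ i (b j) = if i = j then 1 else 0) {η : V [⋀^Fin n]→L[ℝ] ℝ} (hη : η ≠ 0) :
    Function.Bijective fun A : (V →L[ℝ] ℝ) [⋀^Fin k]→L[ℝ] ℝ => interiorMV h b θ A η := by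
  have hn : Module.finrank ℝ V = n := by simpa using Module.finrank_eq_card_basis b
  have hn' : Module.finrank ℝ (V →L[ℝ] ℝ) = n := by
    rw [← (LinearMap.toContinuousLinearMap (𝕜 := ℝ) (E := V) (F' := ℝ)).finrank_eq,
      ← hn]
    exact Subspace.dual_finrank_eq
  obtain ⟨b', hb'⟩ := exists_basis_of_dual hn'
    (θ := fun i => ContinuousLinearMap.apply ℝ ℝ (b i)) (e := θ)
    (by intro i j; simp [hθ, eq_comm])
  obtain rfl : ⇑b' = θ := funext hb'
  -- The reverse injection needs a nonzero top form on the dual space; pulling `η` back by any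
  -- isomorphism supplies one.
  let E : (V →L[ℝ] ℝ) ≃L[ℝ] V := ContinuousLinearEquiv.ofFinrankEq (hn'.trans hn.symm)
  have hη' : η.compContinuousLinearMap (E : (V →L[ℝ] ℝ) →L[ℝ] V) ≠ 0 := fun h0 => hη <| by
    ext v
    simpa [Function.comp_def] using DFunLike.congr_fun h0 fun a => E.symm (v a)
  have h1 := interiorAux_injective (k := k) h b b' hη
  have h2 := interiorAux_injective (k := p) ((add_comm p k).trans h) b' b hη'
  have hfin := le_antisymm (LinearMap.finrank_le_finrank_of_injective h1)
    (LinearMap.finrank_le_finrank_of_injective h2)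
  have hbij : Function.Bijective (((k.factorial : ℝ)⁻¹) • interiorAux (k := k) h b b' η) := by
    have hinj : Function.Injective (((k.factorial : ℝ)⁻¹) • interiorAux (k := k) h b b' η) :=
      fun x y hxy => h1 (smul_right_injective _
        (inv_ne_zero (Nat.cast_ne_zero.2 k.factorial_ne_zero) : (k.factorial : ℝ)⁻¹ ≠ 0) hxy)
    exact ⟨hinj, (LinearMap.injective_iff_surjective_of_finrank_eq_finrank hfin).1 hinj⟩
  exact hbij

end InteriorBijective

/-! ### Powers of a symplectic form are nonzero -/

section WedgePower

variable {V W : Type*} [NormedAddCommGroup V] [NormedSpace ℝ V]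
  [NormedAddCommGroup W] [NormedSpace ℝ W]

theorem wedge_apply {k l : ℕ} (α : V [⋀^Fin k]→L[ℝ] ℝ) (β : V [⋀^Fin l]→L[ℝ] ℝ)
    (v : Fin (k + l) → V) :
    wedge α β v = ((k.factorial * l.factorial : ℕ) : ℝ)⁻¹ *
      ∑ σ : Equiv.Perm (Fin (k + l)), Equiv.Perm.sign σ •
        (α (fun i => v (σ (Fin.castAdd l i))) * β (fun j => v (σ (Fin.natAdd k j)))) := by
  simp only [wedge, ContinuousAlternatingMap.smul_apply, smul_eq_mul,
    ContinuousMultilinearMap.alternatization_apply_apply]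
  rfl

theorem wedge_compContinuousLinearMap {k l : ℕ} (α : V [⋀^Fin k]→L[ℝ] ℝ)
    (β : V [⋀^Fin l]→L[ℝ] ℝ) (f : W →L[ℝ] V) :
    (wedge α β).compContinuousLinearMap f =
      wedge (α.compContinuousLinearMap f) (β.compContinuousLinearMap f) := by
  ext v
  simp only [wedge_apply, ContinuousAlternatingMap.compContinuousLinearMap_apply,
    Function.comp_def]

theorem wedgePow_compContinuousLinearMap (Ω : V [⋀^Fin 2]→L[ℝ] ℝ) (f : W →L[ℝ] V) (j : ℕ) :
    (wedgePow Ω j).compContinuousLinearMap f = wedgePow (Ω.compContinuousLinearMap f) j := by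
  induction j with
  | zero => rfl
  | succ j ih =>
    simp only [wedgePow]
    rw [← ih]
    exact wedge_compContinuousLinearMap _ _ _

/-- The exterior product as a bilinear map. -/
def wedgeₗ (k l : ℕ) : V [⋀^Fin k]→L[ℝ] ℝ →ₗ[ℝ] V [⋀^Fin l]→L[ℝ] ℝ →ₗ[ℝ]
    V [⋀^Fin (k + l)]→L[ℝ] ℝ :=
  LinearMap.mk₂ ℝ wedge
    (fun α α' β => by
      ext v
      simp only [wedge_apply, ContinuousAlternatingMap.add_apply, add_mul, smul_add,
        Finset.sum_add_distrib, mul_add])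
    (fun c α β => by
      ext v
      simp only [wedge_apply, ContinuousAlternatingMap.smul_apply, smul_eq_mul, mul_assoc,
        Finset.mul_sum, mul_smul_comm, mul_left_comm c])
    (fun α β β' => by
      ext v
      simp only [wedge_apply, ContinuousAlternatingMap.add_apply, smul_add,
        Finset.sum_add_distrib, mul_add])
    (fun c α β => by
      ext v
      simp only [wedge_apply, ContinuousAlternatingMap.smul_apply, smul_eq_mul,
        Finset.mul_sum, mul_smul_comm, mul_left_comm c])

/-- The product rule for a bilinear map on finite-dimensional spaces. -/
theorem hasFDerivAt_bilinear {X Y Z E : Type*} [NormedAddCommGroup X] [NormedSpace ℝ X]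
    [NormedAddCommGroup Y] [NormedSpace ℝ Y] [NormedAddCommGroup Z] [NormedSpace ℝ Z]
    [NormedAddCommGroup E] [NormedSpace ℝ E] [FiniteDimensional ℝ X] [FiniteDimensional ℝ Y]
    (B : X →ₗ[ℝ] Y →ₗ[ℝ] Z) {f : E → X} {g : E → Y} {x : E} (hf : DifferentiableAt ℝ f x)
    (hg : DifferentiableAt ℝ g x) : ∃ L : E →L[ℝ] Z, HasFDerivAt (fun x => B (f x) (g x)) L x ∧
      ∀ v, L v = B (fderiv ℝ f x v) (g x) + B (f x) (fderiv ℝ g x v) := by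
  let B' : X →ₗ[ℝ] Y →L[ℝ] Z :=
    { toFun := fun x => LinearMap.toContinuousLinearMap (B x)
      map_add' := fun x y => by simp
      map_smul' := fun c x => by simp }
  refine ⟨_, ((LinearMap.toContinuousLinearMap B').hasFDerivAt.comp x
    hf.hasFDerivAt).clm_apply hg.hasFDerivAt, fun v => ?_⟩
  exact add_comm _ _

theorem differentiable_wedgePow [FiniteDimensional ℝ V] (j : ℕ) :
    Differentiable ℝ fun Ω : V [⋀^Fin 2]→L[ℝ] ℝ => wedgePow Ω j := by
  induction j with
  | zero => exact differentiable_const _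
  | succ j ih =>
    have hL : Differentiable ℝ fun Ω : V [⋀^Fin 2]→L[ℝ] ℝ =>
        wedgeₗ (V := V) (2 * j) 2 (wedgePow Ω j) Ω :=
      fun Ω => (hasFDerivAt_bilinear _ (ih Ω) differentiableAt_id).choose_spec.1.differentiableAt
    exact hL

/-- Symplectic Gram–Schmidt: a nonzero vector `x` orthogonal to the pairs already built exists by
counting dimensions, and a partner of `x` exists by nondegeneracy. -/
theorem exists_symplectic_pairs [FiniteDimensional ℝ V] (B : V →ₗ[ℝ] V →L[ℝ] ℝ)
    (halt : ∀ x, B x x = 0) (hnd : ∀ x, (∀ y, B x y = 0) → x = 0) (j : ℕ)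
    (hj : 2 * j ≤ Module.finrank ℝ V) :
    ∃ v w : Fin j → V, (∀ a b, B (v a) (v b) = 0) ∧ (∀ a b, B (w a) (w b) = 0) ∧
      ∀ a b, B (v a) (w b) = if a = b then 1 else 0 := by
  have hskew : ∀ x y, B x y = -B y x := fun x y => by
    have := halt (x + y)
    simp only [map_add, add_apply, halt] at this
    linarith
  induction j with
  | zero => exact ⟨Fin.elim0, Fin.elim0, fun a => a.elim0, fun a => a.elim0, fun a => a.elim0⟩
  | succ j ih =>
    obtain ⟨v, w, hv, hw, hvw⟩ := ih (by omega)
    let L : V →ₗ[ℝ] (Fin j → ℝ) × (Fin j → ℝ) :=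
      (LinearMap.pi fun a => (B (v a) : V →ₗ[ℝ] ℝ)).prod
        (LinearMap.pi fun a => (B (w a) : V →ₗ[ℝ] ℝ))
    have hker : LinearMap.ker L ≠ ⊥ := LinearMap.ker_ne_bot_of_finrank_lt (by simp; omega)
    obtain ⟨x, hx, hx0⟩ := (Submodule.ne_bot_iff _).1 hker
    have hxv : ∀ a, B (v a) x = 0 := fun a => congrFun (congrArg Prod.fst hx) a
    have hxw : ∀ a, B (w a) x = 0 := fun a => congrFun (congrArg Prod.snd hx) a
    obtain ⟨y₀, hy₀⟩ : ∃ y, B x y ≠ 0 := by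
      by_contra! h
      exact hx0 (hnd x h)
    let y₁ := (B x y₀)⁻¹ • y₀
    have hy₁ : B x y₁ = 1 := by simp [y₁, hy₀]
    -- Corrects the partner to be orthogonal to the earlier pairs; `B x y` stays 1 because `x`
    -- already is. The opposite signs reflect `B (w a) (v a) = -1`.
    let y := y₁ - ∑ a, B (v a) y₁ • w a + ∑ a, B (w a) y₁ • v a
    have hxv' : ∀ a, B x (v a) = 0 := fun a => by rw [hskew, hxv, neg_zero]
    have hxw' : ∀ a, B x (w a) = 0 := fun a => by rw [hskew, hxw, neg_zero]
    have hwv : ∀ a b, B (w a) (v b) = if a = b then -1 else 0 := fun a b => by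
      rw [hskew, hvw]
      by_cases hab : a = b
      · simp [hab]
      · simp [hab, Ne.symm hab]
    have hy : B x y = 1 := by simp [y, hxv', hxw', hy₁]
    have hyv : ∀ a, B (v a) y = 0 := fun a => by simp [y, hv, hvw]
    have hyw : ∀ a, B (w a) y = 0 := fun a => by simp [y, hw, hwv]
    refine ⟨Fin.snoc v x, Fin.snoc w y, ?_, ?_, ?_⟩
    · intro a b
      refine Fin.lastCases ?_ (fun a => ?_) a <;> refine Fin.lastCases ?_ (fun b => ?_) b <;>
        simp [hv, hxv, hxv', halt]
    · intro a b
      refine Fin.lastCases ?_ (fun a => ?_) a <;> refine Fin.lastCases ?_ (fun b => ?_) b <;>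
        simp [hw, hyw, halt]
      rw [hskew, hyw, neg_zero]
    · intro a b
      refine Fin.lastCases ?_ (fun a => ?_) a <;> refine Fin.lastCases ?_ (fun b => ?_) b
      · simp [hy]
      · simp [hxw', Fin.ext_iff]; omega
      · simp [hyv, Fin.ext_iff]; omega
      · simp [hvw, Fin.ext_iff]

/-- The standard symplectic pairing of the indices `0, 1, 2, …`, where `2i` is paired with
`2i + 1`. -/
def stdPairing (a b : ℕ) : ℝ := if a / 2 = b / 2 then ((b % 2 : ℕ) : ℝ) - ((a % 2 : ℕ) : ℝ) else 0

theorem exists_symplectic_family [FiniteDimensional ℝ V] (B : V →ₗ[ℝ] V →L[ℝ] ℝ)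
    (halt : ∀ x, B x x = 0) (hnd : ∀ x, (∀ y, B x y = 0) → x = 0) (j : ℕ)
    (hj : 2 * j ≤ Module.finrank ℝ V) :
    ∃ u : Fin (2 * j) → V, ∀ a b, B (u a) (u b) = stdPairing a b := by
  obtain ⟨v, w, hv, hw, hvw⟩ := exists_symplectic_pairs B halt hnd j hj
  have hwv : ∀ a b, B (w a) (v b) = if a = b then -1 else 0 := fun a b => by
    have := halt (w a + v b)
    simp only [map_add, add_apply, halt, hvw] at this
    by_cases hab : a = b
    · simp only [hab, if_true] at this ⊢; linarith
    · simp only [hab, Ne.symm hab, if_false] at this ⊢; linarith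
  refine ⟨fun a => if a.val % 2 = 0 then v ⟨a / 2, by omega⟩ else w ⟨a / 2, by omega⟩,
    fun a b => ?_⟩
  rcases Nat.mod_two_eq_zero_or_one a.val with ha | ha <;>
    rcases Nat.mod_two_eq_zero_or_one b.val with hb | hb <;>
    simp [ha, hb, hv, hw, hvw, hwv, stdPairing]

/-- If `σ` maps the last pair of indices onto a pair, exchanging that pair with the last one leaves
a permutation preserving the block decomposition `2j + 2`. The exchange is even, so the sign of `σ`
is that of the two blocks. -/
theorem exists_perm_pair {j : ℕ} (σ : Equiv.Perm (Fin (2 * j + 2)))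
    (hσ : (σ (Fin.natAdd (2 * j) 0)).val / 2 = (σ (Fin.natAdd (2 * j) 1)).val / 2) :
    ∃ (τ : Equiv.Perm (Fin (2 * j + 2))) (ρ₁ : Equiv.Perm (Fin (2 * j)))
      (ρ₂ : Equiv.Perm (Fin 2)),
      (∀ a b, stdPairing (τ a) (τ b) = stdPairing a b) ∧
      (∀ i, σ (Fin.castAdd 2 i) = τ (Fin.castAdd 2 (ρ₁ i))) ∧
      (∀ i, σ (Fin.natAdd (2 * j) i) = τ (Fin.natAdd (2 * j) (ρ₂ i))) ∧
      Equiv.Perm.sign σ = Equiv.Perm.sign ρ₁ * Equiv.Perm.sign ρ₂ := by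
  obtain ⟨i, hi⟩ : ∃ i, i = (σ (Fin.natAdd (2 * j) 0)).val / 2 := ⟨_, rfl⟩
  have hij : i ≤ j := by omega
  -- Exchanges pair `i` with pair `j`, preserving parity of indices; it is the identity when `i =
  -- j`.
  let τ : Equiv.Perm (Fin (2 * j + 2)) :=
    Equiv.swap ⟨2 * i, by omega⟩ ⟨2 * j, by omega⟩ *
      Equiv.swap ⟨2 * i + 1, by omega⟩ ⟨2 * j + 1, by omega⟩
  have hτ : ∀ x : Fin (2 * j + 2), (τ x).val =
      if x.val / 2 = i then 2 * j + x.val % 2 else if x.val / 2 = j then 2 * i + x.val % 2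
      else x.val := fun x => by
    simp only [τ, Equiv.Perm.coe_mul, Function.comp_apply, Equiv.swap_apply_def, Fin.ext_iff]
    split_ifs <;> simp_all <;> omega
  have hττ : ∀ x, τ (τ x) = x := fun x => by
    refine Fin.ext ?_
    rw [hτ, hτ]
    split_ifs <;> omega
  have hsign : Equiv.Perm.sign τ = 1 := by
    rcases eq_or_ne i j with rfl | hne
    · simp [τ]
    · rw [Equiv.Perm.sign_mul, Equiv.Perm.sign_swap, Equiv.Perm.sign_swap]
      · rfl
      · simpa [Fin.ext_iff] using hne
      · simpa [Fin.ext_iff] using hne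
  let ρ : Equiv.Perm (Fin (2 * j + 2)) := τ * σ
  have hσρ : ∀ x, σ x = τ (ρ x) := fun x => (hττ _).symm
  have h0 : (ρ (Fin.natAdd (2 * j) 0)).val / 2 = j := by
    change (τ (σ _)).val / 2 = j
    rw [hτ, if_pos hi.symm]; omega
  have h1 : (ρ (Fin.natAdd (2 * j) 1)).val / 2 = j := by
    change (τ (σ _)).val / 2 = j
    rw [hτ, if_pos (hσ ▸ hi.symm)]; omega
  have hρ : ∀ x : Fin (2 * j), (ρ (Fin.castAdd 2 x)).val < 2 * j := fun x => by
    have n0 : (ρ (Fin.castAdd 2 x)).val ≠ (ρ (Fin.natAdd (2 * j) 0)).val := fun h => by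
      have := ρ.injective (Fin.ext h)
      simp [Fin.ext_iff] at this; omega
    have n1 : (ρ (Fin.castAdd 2 x)).val ≠ (ρ (Fin.natAdd (2 * j) 1)).val := fun h => by
      have := ρ.injective (Fin.ext h)
      simp [Fin.ext_iff] at this; omega
    have n2 : (ρ (Fin.natAdd (2 * j) 0)).val ≠ (ρ (Fin.natAdd (2 * j) 1)).val := fun h => by
      have := ρ.injective (Fin.ext h)
      simp [Fin.ext_iff] at this
    omega
  have hmem := Equiv.Perm.mem_sumCongrHom_range_of_perm_mapsTo_inl
    (σ := finSumFinEquiv.symm.permCongr ρ) (m := Fin (2 * j)) (n := Fin 2) (by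
      rintro _ ⟨x, rfl⟩
      refine ⟨⟨_, hρ x⟩, ?_⟩
      simp only [Equiv.permCongr_apply, Equiv.symm_symm, finSumFinEquiv_apply_left]
      rw [Equiv.eq_symm_apply]
      rfl)
  obtain ⟨⟨ρ₁, ρ₂⟩, hρ12⟩ := hmem
  have hval : ∀ z, ρ (finSumFinEquiv z) = finSumFinEquiv (Equiv.Perm.sumCongr ρ₁ ρ₂ z) := fun z => by
    have := Equiv.congr_fun hρ12 z
    simp only [Equiv.Perm.sumCongrHom_apply, Equiv.permCongr_apply, Equiv.symm_symm] at this
    rw [this, Equiv.apply_symm_apply]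
  refine ⟨τ, ρ₁, ρ₂, fun a b => ?_, fun x => ?_, fun x => ?_, ?_⟩
  · have hm : ∀ x, (τ x).val % 2 = x.val % 2 := fun x => by
      rw [hτ]; split_ifs <;> omega
    have hd : (τ a).val / 2 = (τ b).val / 2 ↔ a.val / 2 = b.val / 2 := by
      rw [hτ, hτ]; split_ifs <;> omega
    simp only [stdPairing, hm, hd]
  · rw [hσρ]; exact congrArg τ (hval (Sum.inl x))
  · rw [hσρ]; exact congrArg τ (hval (Sum.inr x))
  · have : Equiv.Perm.sign σ = Equiv.Perm.sign ρ := by simp [ρ, hsign]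
    rw [this, ← Equiv.Perm.sign_sumCongr, ← Equiv.Perm.sign_permCongr finSumFinEquiv.symm ρ, ← hρ12]
    rfl

/-- No term of the sum over permutations is negative. A term vanishes unless the last two slots
receive a pair. Otherwise its sign is absorbed by the alternation of the two factors, and the
induction hypothesis applies to the family rearranged by `τ`. -/
theorem wedgePow_pos (Ω : V [⋀^Fin 2]→L[ℝ] ℝ) (j : ℕ) (u : Fin (2 * j) → V)
    (hu : ∀ a b, Ω ![u a, u b] = stdPairing a b) : 0 < wedgePow Ω j u := by
  induction j with
  | zero => simp [wedgePow]
  | succ j ih =>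
    change 0 < wedge (wedgePow Ω j) Ω u
    rw [wedge_apply]
    have hpair : ∀ (v : Fin (2 * j + 2) → V) , (fun i : Fin 2 => v (Fin.natAdd (2 * j) i)) =
        ![v (Fin.natAdd (2 * j) 0), v (Fin.natAdd (2 * j) 1)] := fun v => by
      ext i; fin_cases i <;> rfl
    have hpos : ∀ σ : Equiv.Perm (Fin (2 * j + 2)),
        (σ (Fin.natAdd (2 * j) 0)).val / 2 = (σ (Fin.natAdd (2 * j) 1)).val / 2 →
        0 < Equiv.Perm.sign σ • (wedgePow Ω j (fun i => u (σ (Fin.castAdd 2 i))) *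
          Ω (fun i => u (σ (Fin.natAdd (2 * j) i)))) := fun σ hσ => by
      obtain ⟨τ, ρ₁, ρ₂, hτ, h1, h2, hs⟩ := exists_perm_pair σ hσ
      have e1 := (wedgePow Ω j).toAlternatingMap.map_perm (fun i => u (τ (Fin.castAdd 2 i))) ρ₁
      have e2 := Ω.toAlternatingMap.map_perm (fun i => u (τ (Fin.natAdd (2 * j) i))) ρ₂
      change wedgePow Ω j (fun i => u (τ (Fin.castAdd 2 (ρ₁ i)))) =
        _ • wedgePow Ω j (fun i => u (τ (Fin.castAdd 2 i))) at e1
      change Ω (fun i => u (τ (Fin.natAdd (2 * j) (ρ₂ i)))) =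
        _ • Ω (fun i => u (τ (Fin.natAdd (2 * j) i))) at e2
      have p1 : 0 < wedgePow Ω j (fun i => u (τ (Fin.castAdd 2 i))) := ih _ fun a b => by
        rw [hu, hτ]; rfl
      have p2 : 0 < Ω (fun i => u (τ (Fin.natAdd (2 * j) i))) := by
        rw [hpair fun i => u (τ i), hu, hτ]
        simp [stdPairing]
        rw [if_pos (by omega)]
        have : (2 * j + 1) % 2 = 1 := by omega
        norm_num [this]
      simp only [h1, h2, e1, e2, hs]
      rcases Int.units_eq_one_or (Equiv.Perm.sign ρ₁) with s1 | s1 <;>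
        rcases Int.units_eq_one_or (Equiv.Perm.sign ρ₂) with s2 | s2 <;>
        simp [s1, s2, mul_pos p1 p2]
    refine mul_pos (by positivity) (Finset.sum_pos' (fun σ _ => ?_)
      ⟨1, Finset.mem_univ _, hpos 1 (by simp; omega)⟩)
    by_cases hσ : (σ (Fin.natAdd (2 * j) 0)).val / 2 = (σ (Fin.natAdd (2 * j) 1)).val / 2
    · exact (hpos σ hσ).le
    · rw [hpair fun i => u (σ i), hu, stdPairing, if_neg hσ]
      simp

theorem wedgePow_ne_zero [FiniteDimensional ℝ V] (Ω : V [⋀^Fin 2]→L[ℝ] ℝ)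
    (hnd : ∀ v, (∀ w, Ω ![v, w] = 0) → v = 0) (j : ℕ) (hj : 2 * j ≤ Module.finrank ℝ V) :
    wedgePow Ω j ≠ 0 := by
  obtain ⟨u, hu⟩ := exists_symplectic_family (interior₂ Ω)
    (fun x => Ω.map_eq_zero_of_eq ![x, x] (i := 0) (j := 1) rfl (by simp)) hnd j hj
  intro h0
  have := wedgePow_pos Ω j u hu
  rw [h0] at this
  exact lt_irrefl _ this

end WedgePower

/-! ### Exterior multiplication by a 1-form against contraction -/

section Contraction

variable {V : Type*} [NormedAddCommGroup V] [NormedSpace ℝ V]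

/-- The sum is `ξ ∧ η` evaluated on `x`, an `(n + 1)`-form on a space of dimension `n`. -/
theorem sum_alternating_top_eq_zero [FiniteDimensional ℝ V] {n : ℕ}
    (hd : Module.finrank ℝ V = n) (ξ : V →L[ℝ] ℝ) (η : V [⋀^Fin n]→L[ℝ] ℝ)
    (x : Fin (n + 1) → V) :
    ∑ i : Fin (n + 1), (-1) ^ (i : ℕ) * (ξ (x i) * η (i.removeNth x)) = 0 := by
  have h0 := (ContinuousAlternatingMap.alternatizeUncurryFin
    (ξ.smulRight η)).toAlternatingMap.map_linearDependent x fun hli => by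
      have := hli.fintype_card_le_finrank
      simp [hd] at this
  have h1 := ContinuousAlternatingMap.alternatizeUncurryFin_apply (ξ.smulRight η) x
  change ContinuousAlternatingMap.alternatizeUncurryFin (ξ.smulRight η) x = 0 at h0
  rw [h0] at h1
  simpa [mul_assoc] using h1.symm

theorem append_of_lt {X : Type*} {k l : ℕ} (u : Fin k → X) (v : Fin l → X) (z : Fin (k + l))
    {c : Fin k} (h : c.val = z.val) : Fin.append u v z = u c := by
  obtain rfl : z = Fin.castAdd l c := Fin.ext h.symm
  simp

theorem append_of_ge {X : Type*} {k l : ℕ} (u : Fin k → X) (v : Fin l → X) (z : Fin (k + l))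
    {c : Fin l} (h : k + c.val = z.val) : Fin.append u v z = v c := by
  obtain rfl : z = Fin.natAdd k c := Fin.ext h.symm
  simp

theorem val_succAbove {n : ℕ} (a : Fin (n + 1)) (z : Fin n) :
    (a.succAbove z).val = if z.val < a.val then z.val else z.val + 1 := by
  simp only [Fin.succAbove, Fin.lt_def, Fin.val_castSucc]
  split_ifs <;> rfl

theorem removeNth_castAdd_append {X : Type*} {k p : ℕ} (h : k + (p + 1) = k + 1 + p)
    (u : Fin (k + 1) → X) (v : Fin (p + 1) → X) (a : Fin (k + 1)) :
    Fin.removeNth (n := k + 1 + p) (α := fun _ => X) (Fin.castAdd (p + 1) a)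
      (Fin.append (m := k + 1) (n := p + 1) u v) =
      Fin.append (a.removeNth u) v ∘ Fin.cast h.symm := by
  funext z
  have hz := val_succAbove (n := k + 1 + p) (Fin.castAdd (p + 1) a) z
  simp only [Fin.val_castAdd] at hz
  rcases lt_or_ge z.val k with hk | hk
  · refine (append_of_lt u v _ (c := a.succAbove ⟨z, hk⟩) ?_).trans
      (append_of_lt (a.removeNth u) v _ (c := ⟨z, hk⟩) rfl).symm
    rw [hz, val_succAbove]
  · refine (append_of_ge u v _ (c := ⟨z - k, by omega⟩) ?_).trans
      (append_of_ge (a.removeNth u) v _ (c := ⟨z - k, by omega⟩) (Nat.add_sub_cancel' hk)).symm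
    rw [hz, if_neg (by omega)]
    simp only
    omega

theorem removeNth_natAdd_append {X : Type*} {k p : ℕ}
    (u : Fin (k + 1) → X) (v : Fin (p + 1) → X) (i : Fin (p + 1)) :
    Fin.removeNth (n := k + 1 + p) (α := fun _ => X) (Fin.natAdd (k + 1) i)
      (Fin.append (m := k + 1) (n := p + 1) u v) =
      Fin.append u (i.removeNth v) := by
  funext z
  have hz := val_succAbove (n := k + 1 + p) (Fin.natAdd (k + 1) i) z
  simp only [Fin.val_natAdd] at hz
  rcases lt_or_ge z.val (k + 1) with hk | hk
  · refine (append_of_lt u v _ (c := ⟨z, hk⟩) ?_).trans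
      (append_of_lt u (i.removeNth v) _ (c := ⟨z, hk⟩) rfl).symm
    rw [hz, if_pos (by omega)]
  · refine (append_of_ge u v _ (c := i.succAbove ⟨z - (k + 1), by omega⟩) ?_).trans
      (append_of_ge u (i.removeNth v) _ (c := ⟨z - (k + 1), by omega⟩)
        (Nat.add_sub_cancel' hk)).symm
    rw [hz, val_succAbove]
    simp only
    split_ifs <;> omega

/-- Split `ξ ∧ η = 0`, evaluated on the concatenation of `u` and `v`, according to whether `ξ` takes
an entry of `u` or of `v`. Entries of `v` sit `k + 1` places further on, whence the sign `(-1) ^ k`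
after moving to the other side. -/
theorem sum_plugLeft_removeNth [FiniteDimensional ℝ V] {k p n : ℕ}
    (hd : Module.finrank ℝ V = n) (h : k + 1 + p = n) (h' : k + (p + 1) = n)
    (ξ : V →L[ℝ] ℝ) (η : V [⋀^Fin n]→L[ℝ] ℝ) (u : Fin (k + 1) → V) (v : Fin (p + 1) → V) :
    ∑ i : Fin (p + 1), (-1) ^ (i : ℕ) * (ξ (v i) * plugLeft h η (i.removeNth v) u) =
      (-1) ^ k * ∑ a : Fin (k + 1),
        (-1) ^ (a : ℕ) * (ξ (u a) * plugLeft h' η v (a.removeNth u)) := by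
  subst h
  have h0 := sum_alternating_top_eq_zero hd ξ η (Fin.append (m := k + 1) (n := p + 1) u v)
  change ∑ i : Fin ((k + 1) + (p + 1)), _ = _ at h0
  rw [Fin.sum_univ_add] at h0
  simp only [Fin.append_left, Fin.append_right, removeNth_natAdd_append,
    removeNth_castAdd_append h', Fin.val_castAdd, Fin.val_natAdd] at h0
  have e1 : ∀ i : Fin (p + 1), plugLeft rfl η (i.removeNth v) u =
      η (Fin.append u (i.removeNth v)) := fun i => rfl
  have e2 : ∀ a : Fin (k + 1), plugLeft h' η v (a.removeNth u) =
      η (Fin.append (a.removeNth u) v ∘ Fin.cast h'.symm) := fun a => rfl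
  simp only [e1, e2]
  simp only [pow_add, pow_one, mul_neg, mul_one, neg_mul, mul_assoc, Finset.sum_neg_distrib,
    ← Finset.mul_sum] at h0
  have hs : ((-1 : ℝ) ^ k) * (-1) ^ k = 1 := by rw [← mul_pow]; simp
  have h1 := congrArg (fun t => (-1 : ℝ) ^ k * t) h0
  simp only [mul_add, mul_neg, ← mul_assoc, hs, one_mul, mul_zero] at h1
  simp only [← mul_assoc]
  linarith

theorem contract_apply {k : ℕ} (ξ : V →L[ℝ] ℝ) (B : (V →L[ℝ] ℝ) [⋀^Fin (k + 1)]→L[ℝ] ℝ)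
    (τ : Fin k → V →L[ℝ] ℝ) : contract ξ B τ = (-1) ^ k * B (Matrix.vecCons ξ τ) := by
  have := B.map_insertNth (Fin.last k) ξ τ
  rw [Fin.insertNth_last'] at this
  change B (Fin.snoc τ ξ) = _
  rw [this]
  simp

/-- `ξ ∧ i(B)η = i(i(ξ)B)η` for `η` of top degree. -/
theorem sum_interiorMV_removeNth [FiniteDimensional ℝ V] {k p n : ℕ}
    (h : k + 1 + p = n) (h' : k + (p + 1) = n) (b : Module.Basis (Fin n) ℝ V)
    {θ : Fin n → V →L[ℝ] ℝ} (hθ : ∀ i j, θ i (b j) = if i = j then 1 else 0)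
    (ξ : V →L[ℝ] ℝ) (B : (V →L[ℝ] ℝ) [⋀^Fin (k + 1)]→L[ℝ] ℝ) (η : V [⋀^Fin n]→L[ℝ] ℝ)
    (v : Fin (p + 1) → V) :
    ∑ i : Fin (p + 1), (-1) ^ (i : ℕ) * (ξ (v i) * interiorMV h b θ B η (i.removeNth v)) =
      interiorMV h' b θ (contract ξ B) η v := by
  have hd : Module.finrank ℝ V = n := by simpa using Module.finrank_eq_card_basis b
  -- The contribution does not depend on the slot `a`: bringing that slot to the front costs `(-1) ^
  -- a`, which cancels the sign present, and summing over its index rebuilds `ξ`.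
  have step : ∀ a : Fin (k + 1),
      ∑ I : Fin (k + 1) → Fin n, B (fun c => θ (I c)) * ((-1) ^ (a : ℕ) *
        (ξ (b (I a)) * plugLeft h' η v (a.removeNth fun c => b (I c)))) =
      ∑ I : Fin k → Fin n, B (Matrix.vecCons ξ fun c => θ (I c)) *
        plugLeft h' η v (fun c => b (I c)) := fun a => by
    rw [← (Fin.insertNthEquiv (fun _ => Fin n) a).sum_comp, Fintype.sum_prod_type,
      Finset.sum_comm]
    refine Finset.sum_congr rfl fun I _ => ?_
    have e1 : ∀ j : Fin n, (fun c => θ (a.insertNth (α := fun _ => Fin n) j I c)) =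
        a.insertNth (α := fun _ => V →L[ℝ] ℝ) (θ j) (fun c => θ (I c)) := fun j => by
      funext c
      refine Fin.succAboveCases a ?_ (fun c => ?_) c <;> simp
    have e2 : ∀ j : Fin n,
        (a.removeNth fun c => b (a.insertNth (α := fun _ => Fin n) j I c)) =
          fun c => b (I c) := fun j => by
      funext c; simp [Fin.removeNth]
    simp only [Fin.insertNthEquiv_apply, e1, e2, Fin.insertNth_apply_same,
      ContinuousAlternatingMap.map_insertNth]
    have hlin : B (Matrix.vecCons ξ fun c => θ (I c)) =
        ∑ j, ξ (b j) * B (Matrix.vecCons (θ j) fun c => θ (I c)) := by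
      have hc : ∀ ζ : V →L[ℝ] ℝ, B (Matrix.vecCons ζ fun c => θ (I c)) =
          B.curryLeft ζ (fun c => θ (I c)) := fun _ => rfl
      simp only [hc]
      conv_lhs => rw [← sum_smul_dual b hθ ξ]
      simp [map_sum]
    rw [hlin, Finset.sum_mul]
    refine Finset.sum_congr rfl fun j _ => ?_
    have hs : ((-1 : ℝ) ^ (a : ℕ)) * (-1) ^ (a : ℕ) = 1 := by rw [← mul_pow]; simp
    simp only [zsmul_eq_mul, Int.cast_pow, Int.cast_neg, Int.cast_one]
    linear_combination (ξ (b j) * B (Matrix.vecCons (θ j) fun c => θ (I c)) *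
      plugLeft h' η v (fun c => b (I c))) * hs
  simp only [interiorMV_apply, contract_apply]
  calc _ = ((k + 1).factorial : ℝ)⁻¹ * ∑ I : Fin (k + 1) → Fin n, B (fun c => θ (I c)) *
        ∑ i : Fin (p + 1), (-1) ^ (i : ℕ) *
          (ξ (v i) * plugLeft h η (i.removeNth v) fun a => b (I a)) := by
        simp only [Finset.mul_sum]
        rw [Finset.sum_comm]
        refine Finset.sum_congr rfl fun I _ => Finset.sum_congr rfl fun i _ => by ring
    _ = ((k + 1).factorial : ℝ)⁻¹ * ((-1) ^ k * ∑ a : Fin (k + 1),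
          ∑ I : Fin (k + 1) → Fin n, B (fun c => θ (I c)) * ((-1) ^ (a : ℕ) *
          (ξ (b (I a)) * plugLeft h' η v (a.removeNth fun c => b (I c))))) := by
        congr 1
        rw [Finset.sum_comm, Finset.mul_sum]
        refine Finset.sum_congr rfl fun I _ => ?_
        rw [sum_plugLeft_removeNth hd h h', ← Finset.mul_sum]
        ring
    -- The `k + 1` equal contributions turn `1 / (k + 1)!` into `1 / k!`, and `(-1) ^ k` is the cost
    -- of moving `ξ` from the last slot to the first.
    _ = _ := by
        simp only [step]
        rw [Finset.sum_const, Finset.card_univ, Fintype.card_fin, nsmul_eq_mul,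
          Nat.factorial_succ]
        simp only [mul_assoc, ← Finset.mul_sum]
        push_cast
        have : (k : ℝ) + 1 ≠ 0 := by positivity
        field_simp

end Contraction

/-! ### Divergence formula in coordinates -/

section LocalFormula

variable {V : Type*} [NormedAddCommGroup V] [NormedSpace ℝ V]

open ContinuousAlternatingMap in
-- Wedge powers commute with pullback by `g`. Differentiating this identity at `g = id` in the
-- direction `G` carries the infinitesimal action of `G` through the power, with no expansion of the
-- wedge product.
theorem fderiv_wedgePow [FiniteDimensional ℝ V] {E : Type*} [NormedAddCommGroup E]
    [NormedSpace ℝ E] {w : E → V [⋀^Fin 2]→L[ℝ] ℝ} {y : E} (hw : DifferentiableAt ℝ w y)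
    (x : E) (G : V →L[ℝ] V)
    (hG : ∀ Y Z, fderiv ℝ w y x ![Y, Z] = w y ![G Y, Z] + w y ![Y, G Z]) (j : ℕ) :
    fderiv ℝ (fun z => wedgePow (w z) j) y x =
      (wedgePow (w y) j).fderivCompContinuousLinearMap (.id ℝ V) G := by
  have hF := (differentiable_wedgePow (V := V) j) (w y)
  have h1 : fderiv ℝ w y x = (w y).fderivCompContinuousLinearMap (.id ℝ V) G := by
    ext v
    obtain ⟨Y, Z, rfl⟩ : ∃ Y Z, v = ![Y, Z] := ⟨v 0, v 1, by ext i; fin_cases i <;> rfl⟩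
    rw [hG, fderivCompContinuousLinearMap_apply, Fin.sum_univ_two]
    congr 2 <;> (ext i; fin_cases i <;> rfl)
  have hpull : ∀ {l : ℕ} (η : V [⋀^Fin l]→L[ℝ] ℝ),
      HasFDerivAt (fun g : V →L[ℝ] V => η.compContinuousLinearMap g)
        (η.fderivCompContinuousLinearMap (.id ℝ V)) (.id ℝ V) := fun η => by
    have := (hasFDerivAt_const η (ContinuousLinearMap.id ℝ V)
      ).continuousAlternatingMapCompContinuousLinearMap (hasFDerivAt_id (𝕜 := ℝ) _)
    simpa using this
  have hF' : HasFDerivAt (fun Ω : V [⋀^Fin 2]→L[ℝ] ℝ => wedgePow Ω j)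
      (fderiv ℝ (fun Ω => wedgePow Ω j) (w y))
      ((w y).compContinuousLinearMap (.id ℝ V)) := by
    have : (w y).compContinuousLinearMap (.id ℝ V) = w y := by ext v; rfl
    rw [this]; exact hF.hasFDerivAt
  have h2 := hF'.comp _ (hpull (w y))
  have h3 := hpull (wedgePow (w y) j)
  simp_rw [wedgePow_compContinuousLinearMap] at h3
  have h4 := DFunLike.congr_fun (h2.unique h3) G
  have h5 := (hF.hasFDerivAt.comp y hw.hasFDerivAt).fderiv
  change fderiv ℝ (fun z => wedgePow (w z) j) y = _ at h5
  rw [h5, ← h4, ContinuousLinearMap.comp_apply, ContinuousLinearMap.comp_apply, h1]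

/-- The interior product as a bilinear map. -/
def interiorMVₗ {d k p n : ℕ} (h : k + p = n) (e : Fin d → V) (θ : Fin d → V →L[ℝ] ℝ) :
    (V →L[ℝ] ℝ) [⋀^Fin k]→L[ℝ] ℝ →ₗ[ℝ] V [⋀^Fin n]→L[ℝ] ℝ →ₗ[ℝ] V [⋀^Fin p]→L[ℝ] ℝ :=
  LinearMap.mk₂ ℝ (interiorMV h e θ)
    (fun A A' η => by
      ext Y
      simp only [interiorMV_apply, ContinuousAlternatingMap.add_apply, add_mul,
        Finset.sum_add_distrib, mul_add])
    (fun c A η => by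
      ext Y
      simp only [interiorMV_apply, ContinuousAlternatingMap.smul_apply, smul_eq_mul, mul_assoc,
        mul_left_comm c, Finset.mul_sum])
    (fun A η η' => by
      ext Y
      simp only [interiorMV_apply, plugLeft_apply, ContinuousAlternatingMap.add_apply, mul_add,
        Finset.sum_add_distrib])
    (fun c A η => by
      ext Y
      simp only [interiorMV_apply, plugLeft_apply, ContinuousAlternatingMap.smul_apply,
        smul_eq_mul, mul_left_comm c, Finset.mul_sum])

theorem interiorMVₗ_apply {d k p n : ℕ} (h : k + p = n) (e : Fin d → V) (θ : Fin d → V →L[ℝ] ℝ)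
    (A : (V →L[ℝ] ℝ) [⋀^Fin k]→L[ℝ] ℝ) (η : V [⋀^Fin n]→L[ℝ] ℝ) :
    interiorMVₗ h e θ A η = interiorMV h e θ A η := rfl

open ContinuousAlternatingMap in
-- Infinitesimal form of the naturality of `i(A)η`. The action of `G` on `η` splits over its slots:
-- in the first `k` it passes to `A` by transposition, in the others it acts on the result.
theorem interiorMV_derivation {d k p n : ℕ} (h : k + p = n)
    (b : Module.Basis (Fin d) ℝ V) {θ : Fin d → V →L[ℝ] ℝ}
    (hθ : ∀ i j, θ i (b j) = if i = j then 1 else 0)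
    (A : (V →L[ℝ] ℝ) [⋀^Fin k]→L[ℝ] ℝ) (η : V [⋀^Fin n]→L[ℝ] ℝ) (G : V →L[ℝ] V) :
    interiorMV h b θ A (η.fderivCompContinuousLinearMap (.id ℝ V) G) =
      interiorMV h b θ (A.fderivCompContinuousLinearMap (.id ℝ _)
        ((ContinuousLinearMap.compL ℝ V V ℝ).flip G)) η +
      (interiorMV h b θ A η).fderivCompContinuousLinearMap (.id ℝ V) G := by
  ext Y
  simp only [ContinuousAlternatingMap.add_apply, interiorMV_apply,
    fderivCompContinuousLinearMap_apply]
  rw [← Finset.mul_sum, ← mul_add]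
  congr 1
  have hpl : ∀ u : Fin k → V, plugLeft h (η.fderivCompContinuousLinearMap (.id ℝ V) G) Y u =
      ∑ a, plugLeft h η Y (fun c =>
        (Function.update (fun _ => .id ℝ V) a G : Fin k → V →L[ℝ] V) c (u c)) +
      ∑ i, plugLeft h η (fun c =>
        (Function.update (fun _ => .id ℝ V) i G : Fin p → V →L[ℝ] V) c (Y c)) u := fun u => by
    subst h
    simp only [plugLeft_apply, fderivCompContinuousLinearMap_apply, Fin.sum_univ_add]
    congr 1 <;> refine Finset.sum_congr rfl fun a _ => congrArg η ?_ <;> funext z <;>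
      refine Fin.addCases (fun c => ?_) (fun c => ?_) z
    · simp [Function.update_apply, Fin.ext_iff]
    · have : Fin.natAdd k c ≠ Fin.castAdd p a := by simp [Fin.ext_iff]; omega
      simp [Function.update_of_ne this]
    · have : Fin.castAdd p c ≠ Fin.natAdd k a := by simp [Fin.ext_iff]; omega
      simp [Function.update_of_ne this]
    · simp [Function.update_apply, Fin.ext_iff]
  simp only [hpl, mul_add, Finset.sum_add_distrib]
  congr 1
  · simp only [Finset.mul_sum, Finset.sum_mul]
    rw [Finset.sum_comm]
    conv_rhs => rw [Finset.sum_comm]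
    refine Finset.sum_congr rfl fun a _ => ?_
    refine (sum_apply_mul_apply b hθ b hθ A.toMultilinearMap (plugLeft h η Y).toMultilinearMap
      (Function.update (fun _ => .id ℝ V) a G)).trans ?_
    refine Finset.sum_congr rfl fun J _ => ?_
    congr 1
    change A _ = A _
    congr 1
    funext c
    by_cases hc : c = a
    · subst hc; simp
    · simp [hc]
  · simp only [Finset.mul_sum]
    rw [Finset.sum_comm]

/-- The covariant derivative of a multivector field with value `A` and derivative `A'` at a point,
for the connection with Christoffel symbols `C`. -/
def covDerivMV {a : ℕ} (A' : V →L[ℝ] (V →L[ℝ] ℝ) [⋀^Fin a]→L[ℝ] ℝ)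
    (A : (V →L[ℝ] ℝ) [⋀^Fin a]→L[ℝ] ℝ) (C : V →L[ℝ] V →L[ℝ] V) :
    V →ₗ[ℝ] (V →L[ℝ] ℝ) [⋀^Fin a]→L[ℝ] ℝ where
  toFun X := A' X + A.fderivCompContinuousLinearMap (.id ℝ _)
    ((ContinuousLinearMap.compL ℝ V V ℝ).flip (C X))
  map_add' X Y := by simp only [map_add]; abel
  map_smul' c X := by simp only [map_smul, smul_add, RingHom.id_apply]

theorem covDerivMV_apply {a : ℕ} (A' : V →L[ℝ] (V →L[ℝ] ℝ) [⋀^Fin a]→L[ℝ] ℝ)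
    (A : (V →L[ℝ] ℝ) [⋀^Fin a]→L[ℝ] ℝ) (C : V →L[ℝ] V →L[ℝ] V) (X : V) :
    covDerivMV A' A C X = A' X + A.fderivCompContinuousLinearMap (.id ℝ _)
      ((ContinuousLinearMap.compL ℝ V V ℝ).flip (C X)) := rfl

theorem covDerivMV_apply_apply {a : ℕ} (A' : V →L[ℝ] (V →L[ℝ] ℝ) [⋀^Fin a]→L[ℝ] ℝ)
    (A : (V →L[ℝ] ℝ) [⋀^Fin a]→L[ℝ] ℝ) (C : V →L[ℝ] V →L[ℝ] V) (X : V)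
    (τ : Fin a → V →L[ℝ] ℝ) : covDerivMV A' A C X τ =
      A' X τ + ∑ i, A (Function.update τ i ((τ i).comp (C X))) := by
  rw [covDerivMV_apply, ContinuousAlternatingMap.add_apply,
    ContinuousAlternatingMap.fderivCompContinuousLinearMap_apply]
  congr 1
  refine Finset.sum_congr rfl fun i _ => congrArg A ?_
  funext j
  by_cases hj : j = i
  · subst hj; simp
  · simp [hj]

/-- In local coordinates, `d (i(A)μ)` is `i(div A)μ`, where the divergence of `A` is taken with
respect to a torsion-free connection that preserves `μ`. -/
theorem extDeriv_interiorMV [FiniteDimensional ℝ V] {k p n : ℕ} (h : k + 1 + p = n)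
    (h' : k + (p + 1) = n) (b : Module.Basis (Fin n) ℝ V) {θ : Fin n → V →L[ℝ] ℝ}
    (hθ : ∀ i j, θ i (b j) = if i = j then 1 else 0)
    {A : V → (V →L[ℝ] ℝ) [⋀^Fin (k + 1)]→L[ℝ] ℝ} {μ : V → V [⋀^Fin n]→L[ℝ] ℝ} {y : V}
    (hA : DifferentiableAt ℝ A y) (hμ : DifferentiableAt ℝ μ y) (C : V →L[ℝ] V →L[ℝ] V)
    (hC : ∀ X Y, C X Y = C Y X)
    (hμC : ∀ X, fderiv ℝ μ y X = (μ y).fderivCompContinuousLinearMap (.id ℝ V) (C X)) :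
    extDeriv (fun z => interiorMV h b θ (A z) (μ z)) y =
      interiorMV h' b θ (∑ j, contract (θ j) (covDerivMV (fderiv ℝ A y) (A y) C (b j)))
        (μ y) := by
  obtain ⟨L, hL, hLv⟩ := hasFDerivAt_bilinear
    (X := (V →L[ℝ] ℝ) [⋀^Fin (k + 1)]→L[ℝ] ℝ) (Y := V [⋀^Fin n]→L[ℝ] ℝ)
    (Z := V [⋀^Fin p]→L[ℝ] ℝ) (interiorMVₗ h b θ) hA hμ
  -- The connection term on the form `i(A)μ`. Subtracting it from the derivative leaves `i(∇_X A)μ`,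
  -- and it disappears under alternation because `C` is symmetric.
  let R : V →L[ℝ] V [⋀^Fin p]→L[ℝ] ℝ :=
    (interiorMV h b θ (A y) (μ y)).fderivCompContinuousLinearMap (.id ℝ V) ∘L C
  let B := covDerivMV (fderiv ℝ A y) (A y) C
  have hT : ∀ X, (L - R) X = interiorMV h b θ (B X) (μ y) := fun X => by
    change L X - R X = _
    rw [hLv, hμC]
    simp only [interiorMVₗ_apply]
    rw [interiorMV_derivation h b hθ]
    change _ + (_ + R X) - R X = _
    rw [← add_assoc, add_sub_cancel_right]
    simp only [← interiorMVₗ_apply, B, covDerivMV_apply, map_add, LinearMap.add_apply]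
  have hR : ContinuousAlternatingMap.alternatizeUncurryFin R = 0 :=
    ContinuousAlternatingMap.alternatizeUncurryFin_fderivCompContinuousLinearMap_eq_zero _ _ hC
  have hL' : ContinuousAlternatingMap.alternatizeUncurryFin L =
      ContinuousAlternatingMap.alternatizeUncurryFin (L - R) := by
    conv_lhs => rw [← sub_add_cancel L R]
    rw [ContinuousAlternatingMap.alternatizeUncurryFin_add, hR, add_zero]
  rw [extDeriv]
  have hf : fderiv ℝ (fun z => interiorMV h b θ (A z) (μ z)) y = L := hL.fderiv
  rw [hf, hL']
  ext v
  rw [ContinuousAlternatingMap.alternatizeUncurryFin_apply]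
  have hB : ∀ X, B X = ∑ j, θ j X • B (b j) := fun X => by
    conv_lhs => rw [← sum_dual_smul b hθ X]
    simp [map_sum]
  have e1 : ∀ i : Fin (p + 1), (L - R) (v i) (i.removeNth v) =
      ∑ j, θ j (v i) * interiorMV h b θ (B (b j)) (μ y) (i.removeNth v) := fun i => by
    rw [hT, hB]
    simp only [← interiorMVₗ_apply, map_sum, map_smul, LinearMap.sum_apply, LinearMap.smul_apply]
    simp
  have e2 : interiorMV h' b θ (∑ j, contract (θ j) (B (b j))) (μ y) v =
      ∑ j, interiorMV h' b θ (contract (θ j) (B (b j))) (μ y) v := by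
    simp only [← interiorMVₗ_apply, map_sum, LinearMap.sum_apply]
    simp
  refine Eq.trans ?_ e2.symm
  simp only [e1, ← sum_interiorMV_removeNth h h' b hθ]
  rw [Finset.sum_comm]
  refine Finset.sum_congr rfl fun i _ => ?_
  simp [Finset.mul_sum]

end LocalFormula

/-! ### Charts, coordinate expressions and cut-off 1-forms -/

section ChartCalculus

variable {n : ℕ} {P : Type*} [TopologicalSpace P] [ChartedSpace (Model n) P]

/-- The derivative of a chart, as an endomorphism of the model space. -/
def dChart (c : OpenPartialHomeomorph P (Model n)) (z : P) : Model n →L[ℝ] Model n :=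
  mfderiv 𝓘(ℝ, Model n) 𝓘(ℝ, Model n) c z

/-- The derivative of the inverse of a chart, as an endomorphism of the model space. -/
def dChartSymm (c : OpenPartialHomeomorph P (Model n)) (y : Model n) : Model n →L[ℝ] Model n :=
  mfderiv 𝓘(ℝ, Model n) 𝓘(ℝ, Model n) c.symm y

/-- The coordinate expression of a 1-form in a chart. -/
def coordOne (c : OpenPartialHomeomorph P (Model n)) (α : OneForm n P) (y : Model n) :
    Model n →L[ℝ] ℝ :=
  ContinuousLinearMap.comp (show Model n →L[ℝ] ℝ from α (c.symm y)) (dChartSymm c y)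

theorem coordOne_apply (c : OpenPartialHomeomorph P (Model n)) (α : OneForm n P) (y v : Model n) :
    coordOne c α y v = α (c.symm y) (dChartSymm c y v) := rfl

/-- 1-covectors as alternating 1-forms. -/
abbrev oneFormLIE (n : ℕ) : (Model n →L[ℝ] ℝ) ≃ₗᵢ[ℝ] ((Model n) [⋀^Fin 1]→L[ℝ] ℝ) :=
  ContinuousAlternatingMap.ofSubsingletonLIE (𝕜 := ℝ) (E := Model n) (F := ℝ) (ι := Fin 1) 0

theorem coordForm_toForm (c : OpenPartialHomeomorph P (Model n)) (α : OneForm n P) (y : Model n) :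
    coordForm c (OneForm.toForm α) y =
      oneFormLIE n (coordOne c α y) := by
  rfl

theorem smoothOneForm_iff {α : OneForm n P} : SmoothOneForm α ↔
    ∀ c ∈ atlas (Model n) P, ContDiffOn ℝ ∞ (coordOne c α) c.target := by
  refine forall₂_congr fun c _ => ?_
  have : coordForm c (OneForm.toForm α) =
      oneFormLIE n ∘ coordOne c α :=
    funext fun y => coordForm_toForm c α y
  rw [this]
  exact (oneFormLIE n).toContinuousLinearEquiv.comp_contDiffOn_iff

theorem SmoothOneForm.add {α β : OneForm n P} (hα : SmoothOneForm α) (hβ : SmoothOneForm β) :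
    SmoothOneForm fun z => α z + β z := by
  rw [smoothOneForm_iff] at *
  intro c hc
  refine ((hα c hc).add (hβ c hc)).congr fun y _ => ?_
  ext v
  rfl

theorem SmoothOneForm.zero : SmoothOneForm fun z : P => (0 : CoT (n := n) z) := by
  rw [smoothOneForm_iff]
  intro c hc
  refine (contDiffOn_const (c := 0)).congr fun y _ => ?_
  ext v
  rfl

section BumpForm

variable {x : P} (φ : SmoothBumpFunction 𝓘(ℝ, Model n) x)

/-- The 1-form on the manifold with coordinate expression `φ a`, for a bump function `φ`. -/
def bumpForm (a : Model n → Model n →L[ℝ] ℝ) : OneForm n P := fun z =>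
  (φ z • (a (chartAt (Model n) x z)).comp (dChart (chartAt (Model n) x) z) : Model n →L[ℝ] ℝ)

theorem bumpForm_apply (a : Model n → Model n →L[ℝ] ℝ) (z : P) (v : Model n) :
    bumpForm φ a z v =
      φ z * a (chartAt (Model n) x z) (dChart (chartAt (Model n) x) z v) := rfl

theorem eventually_bumpForm (a : Model n → Model n →L[ℝ] ℝ) :
    ∀ᶠ z in 𝓝 x, ∀ v : Model n, bumpForm φ a z v =
      a (chartAt (Model n) x z) (dChart (chartAt (Model n) x) z v) := by
  filter_upwards [φ.eventuallyEq_one] with z hz v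
  rw [bumpForm_apply, hz, Pi.one_apply, one_mul]

end BumpForm

variable [IsManifold 𝓘(ℝ, Model n) ∞ P]

theorem mem_maximalAtlas_of_mem_atlas {c : OpenPartialHomeomorph P (Model n)}
    (hc : c ∈ atlas (Model n) P) : c ∈ IsManifold.maximalAtlas 𝓘(ℝ, Model n) ∞ P :=
  IsManifold.subset_maximalAtlas hc

theorem mdifferentiable_of_atlas {c : OpenPartialHomeomorph P (Model n)}
    (hc : c ∈ atlas (Model n) P) : c.MDifferentiable 𝓘(ℝ, Model n) 𝓘(ℝ, Model n) :=
  have : IsManifold 𝓘(ℝ, Model n) 1 P := IsManifold.of_le (n := ∞) (by simp)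
  mdifferentiable_of_mem_atlas hc

theorem dChartSymm_dChart {c : OpenPartialHomeomorph P (Model n)} (hc : c ∈ atlas (Model n) P)
    {z : P} (hz : z ∈ c.source) (v : Model n) : dChartSymm c (c z) (dChart c z v) = v :=
  DFunLike.congr_fun ((mdifferentiable_of_atlas hc).symm_comp_deriv hz) v

theorem dChart_dChartSymm {c : OpenPartialHomeomorph P (Model n)} (hc : c ∈ atlas (Model n) P)
    {y : Model n} (hy : y ∈ c.target) (v : Model n) :
    dChart c (c.symm y) (dChartSymm c y v) = v :=
  DFunLike.congr_fun ((mdifferentiable_of_atlas hc).comp_symm_deriv hy) v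

theorem dChart_self (x : P) : dChart (chartAt (Model n) x) x = .id ℝ (Model n) := by
  have : IsManifold 𝓘(ℝ, Model n) 1 P := IsManifold.of_le (n := ∞) (by simp)
  exact mfderiv_extChartAt_self (I := 𝓘(ℝ, Model n)) (x := x)

theorem dChartSymm_self (x : P) :
    dChartSymm (chartAt (Model n) x) (chartAt (Model n) x x) = .id ℝ (Model n) := by
  ext1 v
  have := dChartSymm_dChart (chart_mem_atlas (Model n) x) (mem_chart_source (Model n) x) v
  rw [dChart_self] at this
  exact this

theorem SmoothOneForm.smul {f : P → ℝ} (hf : SmoothFun (n := n) f) {α : OneForm n P}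
    (hα : SmoothOneForm α) : SmoothOneForm fun z => f z • α z := by
  rw [smoothOneForm_iff] at *
  intro c hc
  have h1 : ContDiffOn ℝ ∞ (f ∘ c.symm) c.target := by
    rw [← contMDiffOn_iff_contDiffOn]
    exact hf.comp_contMDiffOn (contMDiffOn_symm_of_mem_maximalAtlas
      (mem_maximalAtlas_of_mem_atlas hc))
  refine (h1.smul (hα c hc)).congr fun y _ => ?_
  ext v
  rfl

/-- Chain rule; the preferred chart at `x` has derivative the identity at `x`, so no Jacobian
appears. -/
theorem dFun_eq {f : P → ℝ} {g : Model n → ℝ} {x : P}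
    (hfg : f =ᶠ[𝓝 x] g ∘ chartAt (Model n) x)
    (hg : DifferentiableAt ℝ g (chartAt (Model n) x x)) (v : Model n) :
    dFun (n := n) f x v = fderiv ℝ g (chartAt (Model n) x x) v := by
  have h1 : mfderiv 𝓘(ℝ, Model n) 𝓘(ℝ, ℝ) f x =
      mfderiv 𝓘(ℝ, Model n) 𝓘(ℝ, ℝ) (g ∘ chartAt (Model n) x) x := hfg.mfderiv_eq
  have h2 := mfderiv_comp x (I := 𝓘(ℝ, Model n)) (I' := 𝓘(ℝ, Model n)) (I'' := 𝓘(ℝ, ℝ))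
    (g := g) (f := chartAt (Model n) x) hg.mdifferentiableAt
    ((mdifferentiable_of_atlas (chart_mem_atlas _ x)).mdifferentiableAt (mem_chart_source _ x))
  have h3 : mfderiv 𝓘(ℝ, Model n) 𝓘(ℝ, ℝ) g (chartAt (Model n) x x) =
    fderiv ℝ g (chartAt (Model n) x x) := mfderiv_eq_fderiv
  have h4 : dFun (n := n) f x v =
      mfderiv 𝓘(ℝ, Model n) 𝓘(ℝ, ℝ) g (chartAt (Model n) x x) (dChart (chartAt (Model n) x) x v) :=
    DFunLike.congr_fun (h1.trans h2) v
  rw [h4, dChart_self, h3]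
  rfl

theorem extD_apply {k : ℕ} (η : Form n P k) (x : P) (v : Fin (k + 1) → Model n) :
    extD η x v =
      extDeriv (coordForm (chartAt (Model n) x) η) (chartAt (Model n) x x) v := by
  change extDeriv (coordForm (chartAt (Model n) x) η) (chartAt (Model n) x x)
    (fun i => dChart (chartAt (Model n) x) x (v i)) = _
  rw [dChart_self]
  rfl

section Bump

variable {x : P} (φ : SmoothBumpFunction 𝓘(ℝ, Model n) x)

theorem smoothFun_bump [T2Space P] {g : Model n → ℝ}
    (hg : ContDiffOn ℝ ∞ g (chartAt (Model n) x).target) :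
    SmoothFun (n := n) fun z => φ z * g (chartAt (Model n) x z) := by
  refine φ.contMDiff_smul (g := g ∘ chartAt (Model n) x) ?_
  exact (contMDiffOn_iff_contDiffOn.2 hg).comp contMDiffOn_chart
    (chartAt (Model n) x).mapsTo

/-- Within the source of the chart at `x`, the expression in another chart is a product of `φ`, `a`
and the derivative of the transition map. Elsewhere the form vanishes locally, because the closed
support of `φ` lies in that source. -/
theorem smoothOneForm_bumpForm [T2Space P] {a : Model n → Model n →L[ℝ] ℝ}
    (ha : ContDiffOn ℝ ∞ a (chartAt (Model n) x).target) : SmoothOneForm (bumpForm φ a) := by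
  rw [smoothOneForm_iff]
  intro c hc y hy
  refine ContDiffAt.contDiffWithinAt ?_
  set c₀ := chartAt (Model n) x with hc₀
  have hcm := mem_maximalAtlas_of_mem_atlas hc
  have hc₀m : c₀ ∈ IsManifold.maximalAtlas 𝓘(ℝ, Model n) ∞ P :=
    mem_maximalAtlas_of_mem_atlas (chart_mem_atlas _ x)
  have hsymm : ContMDiffAt 𝓘(ℝ, Model n) 𝓘(ℝ, Model n) ∞ c.symm y :=
    contMDiffAt_symm_of_mem_maximalAtlas hcm hy
  have htarget : ∀ᶠ y' in 𝓝 y, y' ∈ c.target := c.open_target.mem_nhds hy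
  by_cases hys : c.symm y ∈ c₀.source
  · have hsource : ∀ᶠ y' in 𝓝 y, c.symm y' ∈ c₀.source :=
      hsymm.continuousAt (c₀.open_source.mem_nhds hys)
    have hφ : ContDiffAt ℝ ∞ (φ ∘ c.symm) y :=
      contMDiffAt_iff_contDiffAt.1 (φ.contMDiffAt.comp y hsymm)
    have ht : ContDiffAt ℝ ∞ (c₀ ∘ c.symm) y :=
      contMDiffAt_iff_contDiffAt.1 ((contMDiffAt_of_mem_maximalAtlas hc₀m hys).comp y hsymm)
    have ha' : ContDiffAt ℝ ∞ a (c₀ (c.symm y)) :=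
      ha.contDiffAt (c₀.open_target.mem_nhds (c₀.map_source hys))
    have hd : ContDiffAt ℝ ∞ (fderiv ℝ (c₀ ∘ c.symm)) y := ht.fderiv_right (by simp)
    refine (hφ.smul ((ContDiffAt.comp y ha' ht).clm_comp hd)).congr_of_eventuallyEq ?_
    filter_upwards [hsource, htarget] with y' h1 h2
    have h3 : fderiv ℝ (c₀ ∘ c.symm) y' =
        (dChart c₀ (c.symm y')).comp (dChartSymm c y') := by
      rw [← mfderiv_eq_fderiv]
      exact mfderiv_comp y' ((mdifferentiable_of_atlas (chart_mem_atlas _ x)).mdifferentiableAt h1)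
        ((mdifferentiable_of_atlas hc).mdifferentiableAt_symm h2)
    ext v
    change _ = φ (c.symm y') * a (c₀ (c.symm y')) (fderiv ℝ (c₀ ∘ c.symm) y' v)
    rw [h3]
    rfl
  · have h0 : ∀ᶠ y' in 𝓝 y, c.symm y' ∈ (tsupport φ)ᶜ :=
      hsymm.continuousAt ((isClosed_tsupport φ).isOpen_compl.mem_nhds
        fun h => hys (φ.tsupport_subset_chartAt_source h))
    refine (contDiffAt_const (c := 0)).congr_of_eventuallyEq ?_
    filter_upwards [h0] with y' h1
    have h2 : φ (c.symm y') = 0 := image_eq_zero_of_notMem_tsupport h1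
    ext v
    rw [coordOne_apply, bumpForm_apply, h2, zero_mul]
    rfl

theorem bumpForm_self (a : Model n → Model n →L[ℝ] ℝ) :
    bumpForm φ a x = a (chartAt (Model n) x x) := by
  ext v
  have := (eventually_bumpForm φ a).self_of_nhds v
  rw [dChart_self] at this
  exact this

theorem coordOne_bumpForm (a : Model n → Model n →L[ℝ] ℝ) :
    coordOne (chartAt (Model n) x) (bumpForm φ a) =ᶠ[𝓝 (chartAt (Model n) x x)] a := by
  have hx := mem_chart_source (Model n) x
  have h1 : ∀ᶠ y in 𝓝 (chartAt (Model n) x x), y ∈ (chartAt (Model n) x).target :=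
    (chartAt (Model n) x).open_target.mem_nhds (mem_chart_target _ x)
  have h2 : Filter.Tendsto (chartAt (Model n) x).symm (𝓝 (chartAt (Model n) x x)) (𝓝 x) := by
    have := (chartAt (Model n) x).continuousAt_symm (mem_chart_target _ x)
    rwa [ContinuousAt, (chartAt (Model n) x).left_inv hx] at this
  filter_upwards [h1, h2.eventually (eventually_bumpForm φ a)] with y hy hb
  ext v
  rw [coordOne_apply]
  refine (hb _).trans ?_
  rw [dChart_dChartSymm (chart_mem_atlas _ x) hy, (chartAt (Model n) x).right_inv hy]

end Bump

end ChartCalculus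

/-! ### Linear algebra of a symplectic torsion-free connection -/

section Christoffel

variable {V : Type*} [NormedAddCommGroup V] [NormedSpace ℝ V]

theorem interior₂_apply (Ω : V [⋀^Fin 2]→L[ℝ] ℝ) (v w : V) : interior₂ Ω v w = Ω ![v, w] := rfl

theorem alternating_swap (Ω : V [⋀^Fin 2]→L[ℝ] ℝ) (v w : V) : Ω ![v, w] = -Ω ![w, v] := by
  have := Ω.toAlternatingMap.map_swap ![w, v] (i := 0) (j := 1) (by simp)
  rw [← ContinuousAlternatingMap.coe_toAlternatingMap, ← this]
  congr 1
  ext i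
  fin_cases i <;> rfl

/-- The map `Ω ↦ i(X)Ω` on 2-forms. -/
def interior₂L [FiniteDimensional ℝ V] (X : V) : V [⋀^Fin 2]→L[ℝ] ℝ →L[ℝ] V →L[ℝ] ℝ :=
  LinearMap.toContinuousLinearMap
    { toFun := fun Ω => interior₂ Ω X
      map_add' := fun Ω Ω' => by ext v; rfl
      map_smul' := fun c Ω => by ext v; rfl }

theorem interior₂L_apply [FiniteDimensional ℝ V] (X : V) (Ω : V [⋀^Fin 2]→L[ℝ] ℝ) :
    interior₂L X Ω = interior₂ Ω X := rfl

/-- Here `w` and `w'` are the value and derivative of `ω`, and `Γ` is the zeroth-order part of `D`.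
The bracket `interior₂ (w' Z) X + Γ Z (F X)` is then `D_{♭Z}(♭X)` for constant `X`, so `hP` is the
Poisson condition and `hT` the torsion condition on such fields. -/
theorem exists_symplectic_christoffel [FiniteDimensional ℝ V] (w : V [⋀^Fin 2]→L[ℝ] ℝ)
    (w' : V →L[ℝ] V [⋀^Fin 2]→L[ℝ] ℝ) (F : V ≃ₗ[ℝ] (V →L[ℝ] ℝ))
    (hF : ∀ X Y, F X Y = w ![X, Y]) (Γ : V →ₗ[ℝ] (V →L[ℝ] ℝ) →ₗ[ℝ] (V →L[ℝ] ℝ))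
    (hP : ∀ X Y Z, w' Z ![X, Y] = (interior₂ (w' Z) X + Γ Z (F X)) Y +
      F X (F.symm (interior₂ (w' Z) Y + Γ Z (F Y))))
    (hT : ∀ X Y Z, (interior₂ (w' X) Y + Γ X (F Y)) Z - (interior₂ (w' Y) X + Γ Y (F X)) Z = 0) :
    ∃ C : V →L[ℝ] V →L[ℝ] V, (∀ X Y, C X Y = C Y X) ∧
      (∀ X Y Z, w' X ![Y, Z] = w ![C X Y, Z] + w ![Y, C X Z]) ∧
      ∀ Z β v, Γ Z β v = -β (C Z v) := by
  -- Forced by the requirement that `♭` commute with differentiation: `C_Z X = ♯ D_{♭Z}(♭X)`.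
  let C₀ : V →ₗ[ℝ] V →L[ℝ] V :=
    { toFun := fun Z => LinearMap.toContinuousLinearMap
        (F.symm.toLinearMap ∘ₗ (interior₂ (w' Z) + Γ Z ∘ₗ F.toLinearMap))
      map_add' := fun Z Z' => by
        ext1 X
        change F.symm (interior₂ (w' (Z + Z')) X + Γ (Z + Z') (F X)) =
          F.symm (interior₂ (w' Z) X + Γ Z (F X)) + F.symm (interior₂ (w' Z') X + Γ Z' (F X))
        rw [← map_add]
        congr 1
        simp only [← interior₂L_apply, map_add, LinearMap.add_apply]
        abel
      map_smul' := fun c Z => by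
        ext1 X
        change F.symm (interior₂ (w' (c • Z)) X + Γ (c • Z) (F X)) =
          c • F.symm (interior₂ (w' Z) X + Γ Z (F X))
        rw [← map_smul]
        congr 1
        simp only [← interior₂L_apply, map_smul, LinearMap.smul_apply, smul_add] }
  let C := LinearMap.toContinuousLinearMap C₀
  have hC : ∀ Z X, F (C Z X) = interior₂ (w' Z) X + Γ Z (F X) := fun Z X =>
    F.apply_symm_apply _
  have hC' : ∀ Z X, C Z X = F.symm (interior₂ (w' Z) X + Γ Z (F X)) := fun Z X => rfl
  have h2 : ∀ X Y Z, w' X ![Y, Z] = w ![C X Y, Z] + w ![Y, C X Z] := fun X Y Z => by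
    rw [hP, ← hC, ← hC', hF, hF]
  refine ⟨C, fun X Y => F.injective ?_, h2, fun Z β v => ?_⟩
  · ext1 Z
    rw [hC, hC]
    exact sub_eq_zero.1 (hT X Y Z)
  · obtain ⟨X, rfl⟩ := F.surjective β
    have h3 := DFunLike.congr_fun (hC Z X) v
    rw [add_apply, hF, interior₂_apply, h2] at h3
    rw [hF]
    linarith

end Christoffel

/-! ### Coordinate expressions at points of a chart -/

section Transport

variable {n : ℕ} {P : Type*} [TopologicalSpace P] [ChartedSpace (Model n) P]

/-- The standard basis of the model space. -/
def modelBasis (n : ℕ) : Module.Basis (Fin n) ℝ (Model n) :=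
  (EuclideanSpace.basisFun (Fin n) ℝ).toBasis

theorem modelBasis_apply (i : Fin n) : modelBasis n i = EuclideanSpace.single i (1 : ℝ) := by
  simp [modelBasis]

theorem proj_modelBasis (i j : Fin n) :
    (EuclideanSpace.proj i : Model n →L[ℝ] ℝ) (modelBasis n j) = if i = j then 1 else 0 := by
  simp [modelBasis_apply]

theorem coordForm_apply_of_mem {k : ℕ} {c : OpenPartialHomeomorph P (Model n)} {z : P}
    (hz : z ∈ c.source) (η : Form n P k) (v : Fin k → Model n) :
    coordForm c η (c z) v = η z (fun i => dChartSymm c (c z) (v i)) := by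
  have key : ∀ z' : P, z' = z → ∀ u : Fin k → Model n, η z' u = η z u := by
    rintro _ rfl u; rfl
  exact key _ (c.left_inv hz) _

theorem coordOne_apply_of_mem {c : OpenPartialHomeomorph P (Model n)} {z : P}
    (hz : z ∈ c.source) (α : OneForm n P) (v : Model n) :
    coordOne c α (c z) v = α z (dChartSymm c (c z) v) := by
  have key : ∀ z' : P, z' = z → ∀ u : Model n, α z' u = α z u := by
    rintro _ rfl u; rfl
  exact key _ (c.left_inv hz) _

theorem eventually_mem_chart_source (x : P) : ∀ᶠ z in 𝓝 x, z ∈ (chartAt (Model n) x).source :=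
  (chartAt (Model n) x).open_source.mem_nhds (mem_chart_source _ x)

theorem SmoothOneForm.differentiableAt {α : OneForm n P} (hα : SmoothOneForm α) (x : P) :
    DifferentiableAt ℝ (coordOne (chartAt (Model n) x) α) (chartAt (Model n) x x) :=
  ((smoothOneForm_iff.1 hα _ (chart_mem_atlas _ x)).contDiffAt
    ((chartAt (Model n) x).open_target.mem_nhds (mem_chart_target _ x))).differentiableAt
    (by simp)

theorem SmoothForm.differentiableAt {k : ℕ} {η : Form n P k} (hη : SmoothForm η) (x : P) :
    DifferentiableAt ℝ (coordForm (chartAt (Model n) x) η) (chartAt (Model n) x x) :=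
  ((hη _ (chart_mem_atlas _ x)).contDiffAt
    ((chartAt (Model n) x).open_target.mem_nhds (mem_chart_target _ x))).differentiableAt
    (by simp)

variable [IsManifold 𝓘(ℝ, Model n) ∞ P]

theorem coordForm_self {k : ℕ} (η : Form n P k) (x : P) :
    coordForm (chartAt (Model n) x) η (chartAt (Model n) x x) = η x := by
  ext v
  rw [coordForm_apply_of_mem (mem_chart_source _ x), dChartSymm_self]
  rfl

theorem coordOne_self (α : OneForm n P) (x : P) :
    coordOne (chartAt (Model n) x) α (chartAt (Model n) x x) = α x := by
  ext v
  rw [coordOne_apply_of_mem (mem_chart_source _ x), dChartSymm_self]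
  rfl

theorem coordOne_dChart {c : OpenPartialHomeomorph P (Model n)} (hc : c ∈ atlas (Model n) P)
    {z : P} (hz : z ∈ c.source) (α : OneForm n P) (v : Model n) :
    coordOne c α (c z) (dChart c z v) = α z v := by
  rw [coordOne_apply_of_mem hz, dChartSymm_dChart hc hz]

end Transport

section SumApply

variable {ι V W : Type*} [AddCommGroup V] [Module ℝ V] [TopologicalSpace V] [AddCommGroup W]
  [Module ℝ W]

theorem sum_smul_dual_apply (s : Finset ι) (f : ι → ℝ) (β : ι → V →L[ℝ] ℝ) (v : V) :
    (∑ i ∈ s, f i • β i) v = ∑ i ∈ s, f i * β i v := by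
  simp [sum_apply]

theorem sum_apply_apply (s : Finset ι) (L : ι → W →ₗ[ℝ] V →L[ℝ] ℝ) (w : W) (v : V) :
    (∑ i ∈ s, L i) w v = ∑ i ∈ s, L i w v := by
  simp [sum_apply]

end SumApply

/-! ### Locality of a contravariant derivative -/

namespace ContravariantDerivative

variable {n : ℕ} {P : Type*} [TopologicalSpace P] [ChartedSpace (Model n) P]
  {Ω : SymplecticForm n P} (D : ContravariantDerivative Ω)

theorem toFun_zero (x : P) : D.toFun (fun _ => 0) x = 0 := by
  have := D.smul 0 (fun _ => 0) SmoothOneForm.zero x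
  simpa using this

theorem toFun_sum {ι : Type*} (s : Finset ι) (α : ι → OneForm n P)
    (hα : ∀ i, SmoothOneForm (α i)) (x : P) :
    SmoothOneForm (fun z => ∑ i ∈ s, α i z) ∧
      D.toFun (fun z => ∑ i ∈ s, α i z) x = ∑ i ∈ s, D.toFun (α i) x := by
  classical
  induction s using Finset.induction_on with
  | empty => simpa using ⟨SmoothOneForm.zero, D.toFun_zero x⟩
  | insert i s his ih =>
    simp only [Finset.sum_insert his]
    exact ⟨(hα i).add ih.1, by rw [D.add _ _ (hα i) ih.1, ih.2]⟩

end ContravariantDerivative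
namespace ContravariantDerivative

variable {n : ℕ} {P : Type*} [TopologicalSpace P] [ChartedSpace (Model n) P]
  {Ω : SymplecticForm n P} (D : ContravariantDerivative Ω)
  [IsManifold 𝓘(ℝ, Model n) ∞ P] [T2Space P]

/-- The contravariant derivative in coordinates. -/
theorem toFun_apply_eq {x : P} (φ : SmoothBumpFunction 𝓘(ℝ, Model n) x) {α : OneForm n P}
    (hα : SmoothOneForm α) (ξ : CoT (n := n) x) (v : T (n := n) x) :
    D.toFun α x ξ v =
      fderiv ℝ (coordOne (chartAt (Model n) x) α) (chartAt (Model n) x x) (Ω.sharp x ξ) v +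
      ∑ i, α x (modelBasis n i) *
        D.toFun (bumpForm φ fun _ => (EuclideanSpace.proj i : Model n →L[ℝ] ℝ)) x ξ v := by
  set c := chartAt (Model n) x with hc
  have hcα : ContDiffOn ℝ ∞ (coordOne c α) c.target :=
    smoothOneForm_iff.1 hα c (chart_mem_atlas _ x)
  let g : Fin n → Model n → ℝ := fun i y => coordOne c α y (modelBasis n i)
  have hg : ∀ i, ContDiffOn ℝ ∞ (g i) c.target := fun i => hcα.clm_apply contDiffOn_const
  let f : Fin n → P → ℝ := fun i z => φ z * g i (c z)
  let ε : Fin n → OneForm n P := fun i =>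
    bumpForm φ fun _ => (EuclideanSpace.proj i : Model n →L[ℝ] ℝ)
  have hf : ∀ i, SmoothFun (n := n) (f i) := fun i => smoothFun_bump φ (hg i)
  have hε : ∀ i, SmoothOneForm (ε i) := fun i => smoothOneForm_bumpForm φ contDiffOn_const
  have hφ : SmoothFun (n := n) fun z => φ z * φ z := φ.contMDiff.smul φ.contMDiff
  have hval : ∀ z (u : Model n), ∑ i, f i z * ε i z u = φ z * φ z * α z u := fun z u => by
    by_cases hz : φ z = 0
    · simp [f, hz]
    · have hzs : z ∈ c.source := φ.support_subset_source hz
      rw [← coordOne_dChart (chart_mem_atlas _ x) hzs,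
        ← sum_smul_dual (modelBasis n) proj_modelBasis (coordOne c α (c z)),
        sum_smul_dual_apply, Finset.mul_sum]
      refine Finset.sum_congr rfl fun i _ => ?_
      simp only [ε, f, bumpForm_apply, g]
      ring
  -- Expands `φ²α` globally as `∑ (φ α_i)(φ dx^i)`, one cut-off for the coefficients and one for the
  -- coordinate forms, so that every factor is smooth on the whole manifold. As `φ = 1` near `x`,
  -- replacing `α` by `φ²α` does not change `Dα` at `x`.
  have hsum : (fun z => ∑ i, f i z • ε i z) = fun z => (φ z * φ z) • α z := by
    funext z
    ext u
    exact (sum_smul_dual_apply _ _ _ _).trans (hval z u)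
  have hd0 : dFun (n := n) (fun z => φ z * φ z) x (Ω.sharp x ξ) = 0 := by
    refine (dFun_eq (g := fun _ => 1) ?_ (differentiableAt_const _) _).trans (by simp; rfl)
    filter_upwards [φ.eventuallyEq_one] with z hz
    simp [hz]
  have hdf : ∀ i, dFun (n := n) (f i) x (Ω.sharp x ξ) =
      fderiv ℝ (coordOne c α) (c x) (Ω.sharp x ξ) (modelBasis n i) := fun i => by
    have hd := hα.differentiableAt x
    refine (dFun_eq (g := g i) ?_ (hd.clm_apply (differentiableAt_const _)) _).trans ?_
    · filter_upwards [φ.eventuallyEq_one] with z hz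
      simp [f, hz]; rfl
    · have := (hd.hasFDerivAt.clm_apply (hasFDerivAt_const (modelBasis n i) (c x))).fderiv
      change fderiv ℝ (g i) _ = _ at this
      rw [this]
      simp; rfl
  have hterm : ∀ i, D.toFun (fun z => f i z • ε i z) x ξ v =
      α x (modelBasis n i) * D.toFun (ε i) x ξ v +
      fderiv ℝ (coordOne c α) (c x) (Ω.sharp x ξ) (modelBasis n i) *
        (EuclideanSpace.proj i : Model n →L[ℝ] ℝ) v := fun i => by
    have e0 := D.leibniz _ _ (hf i) (hε i) x ξ
    have e1 : ε i x = (EuclideanSpace.proj i : Model n →L[ℝ] ℝ) := bumpForm_self φ _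
    have e2 : f i x = α x (modelBasis n i) := by
      simp only [f, g, φ.eq_one, one_mul]
      rw [hc, coordOne_self]
      rfl
    rw [hdf, e1, e2] at e0
    exact DFunLike.congr_fun e0 v
  have h1 : D.toFun (fun z => (φ z * φ z) • α z) x ξ v =
      ∑ i, D.toFun (fun z => f i z • ε i z) x ξ v := by
    rw [← hsum, (D.toFun_sum Finset.univ (fun i z => f i z • ε i z)
      (fun i => (hε i).smul (hf i)) x).2]
    exact sum_apply_apply _ _ _ _
  have h3 : D.toFun (fun z => (φ z * φ z) • α z) x ξ = D.toFun α x ξ := by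
    rw [D.leibniz _ _ hφ hα x ξ, hd0, φ.eq_one, mul_one, one_smul, zero_smul, add_zero]
  rw [← h3, h1]
  simp only [hterm, Finset.sum_add_distrib]
  rw [add_comm]
  congr 1
  have := DFunLike.congr_fun (sum_smul_dual (modelBasis n) proj_modelBasis
    (fderiv ℝ (coordOne c α) (c x) (Ω.sharp x ξ))) v
  exact (sum_smul_dual_apply _ _ _ _).symm.trans this

end ContravariantDerivative

section Combine

variable {V : Type*} [AddCommGroup V] [Module ℝ V] [TopologicalSpace V]

/-- The bilinear map `(Z, β) ↦ ∑ i, β (b i) • L i Z`. -/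
def combine {ι : Type*} [Fintype ι] (b : ι → V) (L : ι → V →ₗ[ℝ] V →L[ℝ] ℝ) :
    V →ₗ[ℝ] (V →L[ℝ] ℝ) →ₗ[ℝ] (V →L[ℝ] ℝ) :=
  LinearMap.mk₂ ℝ (fun Z β => ∑ i, β (b i) • L i Z)
    (fun Z Z' β => by simp [Finset.sum_add_distrib])
    (fun c Z β => by simp [Finset.smul_sum, smul_comm c])
    (fun Z β β' => by simp [add_smul, Finset.sum_add_distrib])
    (fun c Z β => by simp [mul_smul, Finset.smul_sum])

end Combine

/-! ### The bracket of the 1-forms `♭X` with `X` constant in a chart -/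

section ExtDerivLow

variable {V : Type*} [NormedAddCommGroup V] [NormedSpace ℝ V]

theorem extDeriv_two_apply (w : V → V [⋀^Fin 2]→L[ℝ] ℝ) (y X Y Z : V) :
    extDeriv w y ![X, Y, Z] =
      fderiv ℝ w y X ![Y, Z] - fderiv ℝ w y Y ![X, Z] + fderiv ℝ w y Z ![X, Y] := by
  have e0 : (0 : Fin 3).removeNth ![X, Y, Z] = ![Y, Z] := by ext i; fin_cases i <;> rfl
  have e1 : (1 : Fin 3).removeNth ![X, Y, Z] = ![X, Z] := by ext i; fin_cases i <;> rfl
  have e2 : (2 : Fin 3).removeNth ![X, Y, Z] = ![X, Y] := by ext i; fin_cases i <;> rfl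
  rw [extDeriv, ContinuousAlternatingMap.alternatizeUncurryFin_apply, Fin.sum_univ_three, e0, e1,
    e2]
  simp
  ring

theorem extDeriv_ofSubsingleton_apply {a : V → V →L[ℝ] ℝ} {y : V} (ha : DifferentiableAt ℝ a y)
    (X Y : V) :
    extDeriv (fun z => ContinuousAlternatingMap.ofSubsingletonLIE (𝕜 := ℝ) (E := V) (F := ℝ)
      (ι := Fin 1) 0 (a z)) y ![X, Y] = fderiv ℝ a y X Y - fderiv ℝ a y Y X := by
  have e0 : (0 : Fin 2).removeNth ![X, Y] = ![Y] := by ext i; fin_cases i; rfl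
  have e1 : (1 : Fin 2).removeNth ![X, Y] = ![X] := by ext i; fin_cases i; rfl
  let L : (V →L[ℝ] ℝ) →L[ℝ] V [⋀^Fin 1]→L[ℝ] ℝ :=
    (ContinuousAlternatingMap.ofSubsingletonLIE (𝕜 := ℝ) (E := V) (F := ℝ)
      (ι := Fin 1) 0).toContinuousLinearEquiv.toContinuousLinearMap
  have hL : fderiv ℝ (fun z => L (a z)) y = L.comp (fderiv ℝ a y) :=
    (L.hasFDerivAt.comp y ha.hasFDerivAt).fderiv
  change extDeriv (fun z => L (a z)) y _ = _
  rw [extDeriv, ContinuousAlternatingMap.alternatizeUncurryFin_apply, Fin.sum_univ_two, e0, e1, hL]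
  have h (X Y : V) : L.comp (fderiv ℝ a y) X ![Y] = fderiv ℝ a y X Y := rfl
  rw [h, h]
  simp
  ring

end ExtDerivLow

variable {n : ℕ} {P : Type*} [TopologicalSpace P] [ChartedSpace (Model n) P]

theorem SymplecticForm.fderiv_interior₂_coordForm (Ω : SymplecticForm n P) {x : P}
    (X Z : Model n) :
    fderiv ℝ (fun y => interior₂ (coordForm (chartAt (Model n) x) Ω.form y) X)
      (chartAt (Model n) x x) Z =
    interior₂ (fderiv ℝ (coordForm (chartAt (Model n) x) Ω.form) (chartAt (Model n) x x) Z) X := by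
  have := ((interior₂L X).hasFDerivAt.comp _ (Ω.smooth.differentiableAt x).hasFDerivAt).fderiv
  exact DFunLike.congr_fun this Z

variable [IsManifold 𝓘(ℝ, Model n) ∞ P]

theorem extD_bumpForm_apply {x : P} (φ : SmoothBumpFunction 𝓘(ℝ, Model n) x)
    {a : Model n → Model n →L[ℝ] ℝ} (ha : DifferentiableAt ℝ a (chartAt (Model n) x x))
    (X Y : Model n) :
    extD (OneForm.toForm (bumpForm φ a)) x ![X, Y] =
      fderiv ℝ a (chartAt (Model n) x x) X Y - fderiv ℝ a (chartAt (Model n) x x) Y X := by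
  have h : coordForm (chartAt (Model n) x) (OneForm.toForm (bumpForm φ a))
      =ᶠ[𝓝 (chartAt (Model n) x x)] fun y => oneFormLIE n (a y) := by
    filter_upwards [coordOne_bumpForm φ a] with y hy
    rw [coordForm_toForm, hy]
  refine (extD_apply _ _ ![X, Y]).trans ?_
  rw [h.extDeriv_eq, extDeriv_ofSubsingleton_apply ha]

namespace SymplecticForm

variable (Ω : SymplecticForm n P) {x : P} (φ : SmoothBumpFunction 𝓘(ℝ, Model n) x)

/-- The 1-form `♭X`, for a vector field `X` that is constant in coordinates, cut off. -/
def flatConst (X : Model n) : OneForm n P :=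
  bumpForm φ fun y => interior₂ (coordForm (chartAt (Model n) x) Ω.form y) X

theorem smoothOneForm_flatConst [T2Space P] (X : Model n) :
    SmoothOneForm (Ω.flatConst φ X) :=
  smoothOneForm_bumpForm φ
    ((interior₂L X).contDiff.comp_contDiffOn (Ω.smooth _ (chart_mem_atlas _ x)))

theorem eventually_flatConst (X : Model n) :
    ∀ᶠ z in 𝓝 x, Ω.flatConst φ X z =
      Ω.flat z (dChartSymm (chartAt (Model n) x) (chartAt (Model n) x z) X) := by
  filter_upwards [eventually_bumpForm φ
    fun y => interior₂ (coordForm (chartAt (Model n) x) Ω.form y) X,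
    eventually_mem_chart_source (n := n) x] with z h1 hz
  ext v
  refine (h1 v).trans ?_
  refine (coordForm_apply_of_mem hz _ _).trans ?_
  refine congrArg (Ω.form z) ?_
  ext1 i
  fin_cases i
  · rfl
  · exact dChartSymm_dChart (chart_mem_atlas _ x) hz v

theorem flatConst_self (X : Model n) : Ω.flatConst φ X x = Ω.flat x X := by
  have := (Ω.eventually_flatConst φ X).self_of_nhds
  rwa [dChartSymm_self] at this

theorem eventually_flatConst_sharp (X Y : Model n) :
    ∀ᶠ z in 𝓝 x, Ω.flatConst φ X z (Ω.sharp z (Ω.flatConst φ Y z)) =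
      coordForm (chartAt (Model n) x) Ω.form (chartAt (Model n) x z) ![X, Y] := by
  filter_upwards [Ω.eventually_flatConst φ X, Ω.eventually_flatConst φ Y,
    eventually_mem_chart_source (n := n) x] with z h1 h2 hz
  have h3 : Ω.sharp z (Ω.flatConst φ Y z) =
      dChartSymm (chartAt (Model n) x) (chartAt (Model n) x z) Y := by
    rw [h2]
    exact (Ω.flat z).symm_apply_apply _
  rw [h3, h1, coordForm_apply_of_mem hz]
  refine congrArg (Ω.form z) ?_
  ext1 i
  fin_cases i <;> rfl

theorem dFun_flatConst_sharp (X Y Z : Model n) :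
    dFun (n := n) (fun z => Ω.flatConst φ X z (Ω.sharp z (Ω.flatConst φ Y z))) x Z =
      fderiv ℝ (coordForm (chartAt (Model n) x) Ω.form) (chartAt (Model n) x x) Z ![X, Y] := by
  have h1 := (((interior₂L X).hasFDerivAt.comp _
    (Ω.smooth.differentiableAt x).hasFDerivAt).clm_apply
      (hasFDerivAt_const Y (chartAt (Model n) x x)))
  refine (dFun_eq (g := fun y => coordForm (chartAt (Model n) x) Ω.form y ![X, Y])
    (Ω.eventually_flatConst_sharp φ X Y) h1.differentiableAt Z).trans ?_
  refine (DFunLike.congr_fun h1.fderiv Z).trans ?_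
  simp
  rfl

/-- In Cartan's formula the term `-∂_V ω(Y, X)` of `d(♭Y)(X, V)` cancels against `d(ω(Y, X))(V)`. -/
theorem lieDeriv_flatConst (X Y V : Model n) :
    lieDeriv (fun z => Ω.sharp z (Ω.flatConst φ X z)) (Ω.flatConst φ Y) x V =
      fderiv ℝ (coordForm (chartAt (Model n) x) Ω.form) (chartAt (Model n) x x) X ![Y, V] := by
  have h1 : Ω.sharp x (Ω.flatConst φ X x) = X := by
    rw [flatConst_self]
    exact (Ω.flat x).symm_apply_apply _
  have h2 : lieDeriv (fun z => Ω.sharp z (Ω.flatConst φ X z)) (Ω.flatConst φ Y) x V =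
      extD (OneForm.toForm (Ω.flatConst φ Y)) x ![Ω.sharp x (Ω.flatConst φ X x), V] +
      dFun (n := n) (fun z => Ω.flatConst φ Y z (Ω.sharp z (Ω.flatConst φ X z))) x V := rfl
  have h3 := extD_bumpForm_apply φ
    (a := fun y => interior₂ (coordForm (chartAt (Model n) x) Ω.form y) Y)
    ((interior₂L Y).differentiableAt.comp _ (Ω.smooth.differentiableAt x)) X V
  rw [fderiv_interior₂_coordForm, fderiv_interior₂_coordForm] at h3
  rw [h2, h1, dFun_flatConst_sharp]
  refine (congrArg (· + _) h3).trans ?_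
  simp only [interior₂_apply]
  ring

/-- The three terms of the bracket add up to `dω(X, Y, V)`; this is where closedness of `ω` is used.
-/
theorem bracket_flatConst (X Y V : Model n) :
    Ω.bracket (Ω.flatConst φ X) (Ω.flatConst φ Y) x V = 0 := by
  have h1 : Ω.bracket (Ω.flatConst φ X) (Ω.flatConst φ Y) x V =
    lieDeriv (fun z => Ω.sharp z (Ω.flatConst φ X z)) (Ω.flatConst φ Y) x V -
    lieDeriv (fun z => Ω.sharp z (Ω.flatConst φ Y z)) (Ω.flatConst φ X) x V +
    dFun (n := n) (fun z => Ω.flatConst φ X z (Ω.sharp z (Ω.flatConst φ Y z))) x V := rfl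
  rw [h1, lieDeriv_flatConst, lieDeriv_flatConst, dFun_flatConst_sharp, ← extDeriv_two_apply]
  refine (extD_apply Ω.form x ![X, Y, V]).symm.trans ?_
  rw [Ω.closed]
  rfl

end SymplecticForm

/-! ### Christoffel symbols of a torsion-free Poisson connection -/

namespace ContravariantDerivative

variable {Ω : SymplecticForm n P} (D : ContravariantDerivative Ω)

/-- The zeroth order part of a contravariant derivative in coordinates. -/
def christoffel {x : P} (φ : SmoothBumpFunction 𝓘(ℝ, Model n) x) :
    Model n →ₗ[ℝ] (Model n →L[ℝ] ℝ) →ₗ[ℝ] (Model n →L[ℝ] ℝ) :=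
  combine (modelBasis n) fun i =>
    (D.toFun (bumpForm φ fun _ => (EuclideanSpace.proj i : Model n →L[ℝ] ℝ)) x) ∘ₗ
      (Ω.flat x).toLinearMap

variable [T2Space P]

theorem toFun_apply_eq_christoffel {x : P} (φ : SmoothBumpFunction 𝓘(ℝ, Model n) x)
    {α : OneForm n P} (hα : SmoothOneForm α) (Z v : Model n) :
    D.toFun α x (Ω.flat x Z) v =
      fderiv ℝ (coordOne (chartAt (Model n) x) α) (chartAt (Model n) x x) Z v +
      D.christoffel φ Z (α x) v := by
  have h1 : Ω.sharp x (Ω.flat x Z) = Z := (Ω.flat x).symm_apply_apply _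
  have := D.toFun_apply_eq φ hα (Ω.flat x Z) v
  rw [h1] at this
  refine this.trans (congrArg _ ?_)
  exact (sum_smul_dual_apply _ _ _ _).symm

theorem toFun_flatConst {x : P} (φ : SmoothBumpFunction 𝓘(ℝ, Model n) x) (X Z : Model n) :
    D.toFun (Ω.flatConst φ X) x (Ω.flat x Z) =
      (interior₂ (fderiv ℝ (coordForm (chartAt (Model n) x) Ω.form) (chartAt (Model n) x x) Z) X +
      D.christoffel φ Z (Ω.flat x X) : Model n →L[ℝ] ℝ) := by
  ext1 v
  refine (D.toFun_apply_eq_christoffel φ (Ω.smoothOneForm_flatConst φ X) Z v).trans ?_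
  rw [Ω.flatConst_self φ X, SymplecticForm.flatConst, (coordOne_bumpForm φ _).fderiv_eq,
    Ω.fderiv_interior₂_coordForm X Z]
  rfl

/-- A torsion-free Poisson connection is, in coordinates at a point, given by symmetric
coefficients that make the symplectic form parallel. -/
theorem exists_christoffel (hD : D.IsPoisson) (hT : D.IsTorsionFree) (x : P) :
    ∃ C : Model n →L[ℝ] Model n →L[ℝ] Model n, (∀ X Y, C X Y = C Y X) ∧
      (∀ X Y Z, fderiv ℝ (coordForm (chartAt (Model n) x) Ω.form) (chartAt (Model n) x x) X ![Y, Z] =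
        coordForm (chartAt (Model n) x) Ω.form (chartAt (Model n) x x) ![C X Y, Z] +
        coordForm (chartAt (Model n) x) Ω.form (chartAt (Model n) x x) ![Y, C X Z]) ∧
      ∀ α : OneForm n P, SmoothOneForm α → ∀ Z v : Model n,
        D.toFun α x (Ω.flat x Z) v =
          fderiv ℝ (coordOne (chartAt (Model n) x) α) (chartAt (Model n) x x) Z v -
          α x (C Z v) := by
  obtain ⟨φ⟩ : Nonempty (SmoothBumpFunction 𝓘(ℝ, Model n) x) := inferInstance
  obtain ⟨C, h1, h2, h3⟩ := exists_symplectic_christoffel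
    (coordForm (chartAt (Model n) x) Ω.form (chartAt (Model n) x x))
    (fderiv ℝ (coordForm (chartAt (Model n) x) Ω.form) (chartAt (Model n) x x))
    (Ω.flat x) (fun X Y => by rw [coordForm_self]; rfl) (D.christoffel φ)
    (fun (X Y Z : T (n := n) x) => by
      have := hD _ _ (Ω.smoothOneForm_flatConst φ X) (Ω.smoothOneForm_flatConst φ Y) x
        (Ω.flat x Z)
      have e : ∀ W, Ω.sharp x (Ω.flat x W) = W := (Ω.flat x).symm_apply_apply
      rw [e] at this
      refine ((Ω.dFun_flatConst_sharp φ X Y Z).symm.trans this).trans ?_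
      rw [D.toFun_flatConst φ X Z, D.toFun_flatConst φ Y Z, Ω.flatConst_self φ X,
        Ω.flatConst_self φ Y]
      exact congrArg₂ (· + ·) (congrArg _ (e Y)) rfl)
    (fun X Y Z => by
      have := hT _ _ (Ω.smoothOneForm_flatConst φ X) (Ω.smoothOneForm_flatConst φ Y) x
      rw [Ω.flatConst_self, Ω.flatConst_self, toFun_flatConst, toFun_flatConst] at this
      have h4 := DFunLike.congr_fun this Z
      have h5 := Ω.bracket_flatConst φ X Y Z
      refine Eq.trans ?_ ((congrArg₂ (· + ·) h4 h5).trans (add_zero 0))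
      exact (sub_add_cancel _ _).symm)
  refine ⟨C, h1, h2, fun α hα Z v => ?_⟩
  rw [D.toFun_apply_eq_christoffel φ hα, sub_eq_add_neg]
  exact congrArg _ (h3 Z (α x) v)

end ContravariantDerivative

/-! ### Covariant derivatives and contractions of multivectors -/

section Covariant

variable {V : Type*} [NormedAddCommGroup V] [NormedSpace ℝ V]

theorem covDerivMV_apply_eq_sub {a : ℕ} (A' : V →L[ℝ] (V →L[ℝ] ℝ) [⋀^Fin a]→L[ℝ] ℝ)
    (A : (V →L[ℝ] ℝ) [⋀^Fin a]→L[ℝ] ℝ) (C : V →L[ℝ] V →L[ℝ] V) (X : V)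
    (τ τ' : Fin a → V →L[ℝ] ℝ) : covDerivMV A' A C X τ =
      A' X τ + ∑ i, A (Function.update τ i (τ' i)) -
        ∑ i, A (Function.update τ i (τ' i - (τ i).comp (C X))) := by
  rw [covDerivMV_apply_apply]
  simp only [ContinuousAlternatingMap.map_update_sub, Finset.sum_sub_distrib]
  ring

end Covariant

section Contract

variable {V : Type*} [NormedAddCommGroup V] [NormedSpace ℝ V]

theorem contract_eq_curryLeft {k : ℕ} (ξ : V →L[ℝ] ℝ)
    (B : (V →L[ℝ] ℝ) [⋀^Fin (k + 1)]→L[ℝ] ℝ) :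
    contract ξ B = (-1 : ℝ) ^ k • B.curryLeft ξ := by
  ext τ
  rw [contract_apply]
  rfl

/-- The interior product by 1-forms, as a bilinear map. -/
def contractₗ (k : ℕ) : (V →L[ℝ] ℝ) →ₗ[ℝ] (V →L[ℝ] ℝ) [⋀^Fin (k + 1)]→L[ℝ] ℝ →ₗ[ℝ]
    (V →L[ℝ] ℝ) [⋀^Fin k]→L[ℝ] ℝ :=
  LinearMap.mk₂ ℝ contract
    (fun ξ ξ' B => by simp only [contract_eq_curryLeft, map_add, smul_add])
    (fun c ξ B => by simp only [contract_eq_curryLeft, map_smul, smul_comm c])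
    (fun ξ B B' => by ext τ; rfl)
    (fun c ξ B => by ext τ; rfl)

/-- The tensors `∑ ♭b'_i ⊗ ♯θ'^i` and `-∑ θ^j ⊗ b_j` coincide: expand `♭b'_i` in the `θ^j` and use
skewness of `ω`. This is the source of the minus sign in the theorem. -/
theorem sum_contract_dual (w : V [⋀^Fin 2]→L[ℝ] ℝ) (F : V ≃ₗ[ℝ] (V →L[ℝ] ℝ))
    (hF : ∀ X Y, F X Y = w ![X, Y]) {ι κ : Type*} [Fintype ι] [DecidableEq ι] [Fintype κ]
    [DecidableEq κ] (b : Module.Basis ι ℝ V) {θ : ι → V →L[ℝ] ℝ}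
    (hθ : ∀ i j, θ i (b j) = if i = j then 1 else 0) (b' : Module.Basis κ ℝ V)
    {θ' : κ → V →L[ℝ] ℝ} (hθ' : ∀ i j, θ' i (b' j) = if i = j then 1 else 0) {k : ℕ}
    (B : V →ₗ[ℝ] (V →L[ℝ] ℝ) [⋀^Fin (k + 1)]→L[ℝ] ℝ) :
    ∑ i, contract (F (b' i)) (B (F.symm (θ' i))) = -∑ j, contract (θ j) (B (b j)) := by
  have h1 : ∀ j, ∑ i, F (b' i) (b j) • F.symm (θ' i) = -b j := fun j => by
    apply F.injective
    rw [map_sum, map_neg, ← sum_smul_dual b' hθ' (F (b j)), ← Finset.sum_neg_distrib]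
    refine Finset.sum_congr rfl fun i _ => ?_
    rw [map_smul, F.apply_symm_apply, hF, hF, alternating_swap]
    exact neg_smul (w ![b j, b' i]) (θ' i)
  have h2 : ∀ i, contract (F (b' i)) (B (F.symm (θ' i))) =
      ∑ j, F (b' i) (b j) • contractₗ k (θ j) (B (F.symm (θ' i))) := fun i => by
    refine (congrArg (fun ξ : V →L[ℝ] ℝ => contractₗ k ξ (B (F.symm (θ' i))))
      (sum_smul_dual b hθ (F (b' i))).symm).trans ?_
    simp only [map_sum, map_smul, LinearMap.sum_apply, LinearMap.smul_apply]
  have h3 : ∀ j, ∑ i, F (b' i) (b j) • contractₗ k (θ j) (B (F.symm (θ' i))) =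
      (-1 : ℝ) • contract (θ j) (B (b j)) := fun j => by
    have := congrArg (fun v => contractₗ k (θ j) (B v))
      ((h1 j).trans (neg_one_smul ℝ (b j)).symm)
    simp only [map_sum, map_smul] at this
    exact this
  simp only [h2]
  rw [Finset.sum_comm]
  simp only [h3]
  rw [← Finset.smul_sum]
  exact neg_one_smul ℝ (∑ j, contract (θ j) (B (b j)))

end Contract

/-! ### Multivector fields in charts and the extension of `D` -/

section Multivectors

variable {n : ℕ} {P : Type*} [TopologicalSpace P] [ChartedSpace (Model n) P]

theorem SmoothMV.differentiableAt {a : ℕ} {K : MVField n P a} (hK : SmoothMV K) (x : P) :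
    DifferentiableAt ℝ (coordMV (chartAt (Model n) x) K) (chartAt (Model n) x x) :=
  ((hK _ (chart_mem_atlas _ x)).contDiffAt
    ((chartAt (Model n) x).open_target.mem_nhds (mem_chart_target _ x))).differentiableAt
    (by simp)

theorem coordMV_apply_of_mem {a : ℕ} {c : OpenPartialHomeomorph P (Model n)} {z : P}
    (hz : z ∈ c.source) (K : MVField n P a) (τ : Fin a → Model n →L[ℝ] ℝ) :
    coordMV c K (c z) τ = K z (fun i => (τ i).comp (dChart c z)) := by
  have key : ∀ z' : P, z' = z →
      K z' (fun i => (τ i).comp (dChart c z')) = K z (fun i => (τ i).comp (dChart c z)) := by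
    rintro _ rfl; rfl
  exact key _ (c.left_inv hz)

theorem muFlat_eq {k p : ℕ} (h : k + p = n) (μ : Form n P n) (x : P) :
    muFlat h μ x = fun A : (Model n →L[ℝ] ℝ) [⋀^Fin k]→L[ℝ] ℝ =>
      interiorMV h (modelBasis n) (fun i => (EuclideanSpace.proj i : Model n →L[ℝ] ℝ)) A (μ x) := by
  have : ⇑(modelBasis n) = fun i => EuclideanSpace.single i (1 : ℝ) := funext modelBasis_apply
  rw [this]
  rfl

variable [IsManifold 𝓘(ℝ, Model n) ∞ P]

theorem coordMV_self {a : ℕ} (K : MVField n P a) (x : P) :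
    coordMV (chartAt (Model n) x) K (chartAt (Model n) x x) = K x := by
  ext τ
  rw [coordMV_apply_of_mem (mem_chart_source _ x), dChart_self]
  rfl

theorem coordMV_coordOne {a : ℕ} {c : OpenPartialHomeomorph P (Model n)}
    (hc : c ∈ atlas (Model n) P) {z : P} (hz : z ∈ c.source) (K : MVField n P a)
    (α : Fin a → OneForm n P) :
    coordMV c K (c z) (fun i => coordOne c (α i) (c z)) = K z (fun i => α i z) := by
  rw [coordMV_apply_of_mem hz]
  refine congrArg (K z) (funext fun i => ?_)
  ext v
  exact coordOne_dChart hc hz (α i) v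

/-- Needed on the whole chart domain, since `d` sees a neighbourhood. The operator `muFlat` uses the
standard basis of each tangent space, which is not the coordinate frame of `c`; naturality of the
interior product absorbs the difference. -/
theorem coordForm_muFlat {k p : ℕ} (h : k + p = n) (μ : Form n P n) (K : MVField n P k)
    {c : OpenPartialHomeomorph P (Model n)} (hc : c ∈ atlas (Model n) P) {y : Model n}
    (hy : y ∈ c.target) :
    coordForm c (fun z => muFlat h μ z (K z)) y =
      interiorMV h (modelBasis n) (fun i => (EuclideanSpace.proj i : Model n →L[ℝ] ℝ))
        (coordMV c K y) (coordForm c μ y) := by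
  have h1 : ∀ v, dChartSymm c y (dChart c (c.symm y) v) = v := fun v => by
    have := dChartSymm_dChart hc (c.map_target hy) v
    rwa [c.right_inv hy] at this
  refine Eq.trans ?_ (interiorMV_comp h (modelBasis n) proj_modelBasis (modelBasis n)
    proj_modelBasis (K (c.symm y)) (μ (c.symm y)) (dChart c (c.symm y)) (dChartSymm c y) h1)
  exact congrArg (fun η : (Model n) [⋀^Fin p]→L[ℝ] ℝ =>
    η.compContinuousLinearMap (dChartSymm c y)) (congrFun (muFlat_eq h μ (c.symm y)) _)

namespace ContravariantDerivative

variable {Ω : SymplecticForm n P} (D : ContravariantDerivative Ω)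

/-- By the product rule, the derivatives of the `α_i` in `(♯ξ)⟨α_1 ∧ ⋯ ∧ α_a, K⟩` cancel those in
`D_ξ α_i`; the derivative of `K` and the terms in `C` remain. Only values at `x` are involved, so
`C` may depend on `x` arbitrarily. -/
theorem isExtension_covDerivMV {a : ℕ} {K : MVField n P a} (hK : SmoothMV K)
    (C : P → Model n →L[ℝ] Model n →L[ℝ] Model n)
    (hC : ∀ x, ∀ α : OneForm n P, SmoothOneForm α → ∀ Z v : Model n,
      D.toFun α x (Ω.flat x Z) v =
        fderiv ℝ (coordOne (chartAt (Model n) x) α) (chartAt (Model n) x x) Z v - α x (C x Z v)) :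
    D.IsExtension K fun x =>
      covDerivMV (fderiv ℝ (coordMV (chartAt (Model n) x) K) (chartAt (Model n) x x)) (K x) (C x) ∘ₗ
        (Ω.sharp x).toLinearMap := by
  intro α hα x ξ
  obtain ⟨Z, rfl⟩ := (Ω.flat x).surjective ξ
  have hZ : Ω.sharp x (Ω.flat x Z) = Z := (Ω.flat x).symm_apply_apply _
  have hdα := fun i => (hα i).differentiableAt x
  have hd := (hK.differentiableAt x).continuousAlternatingMap_apply hdα
  have h1 : dFun (n := n) (fun z => K z fun i => α i z) x Z = _ := dFun_eq (by
    filter_upwards [eventually_mem_chart_source (n := n) x] with z hz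
    exact (coordMV_coordOne (chart_mem_atlas _ x) hz K α).symm) hd Z
  have h3 := h1.trans
    (fderiv_continuousAlternatingMap_apply_apply (hK.differentiableAt x) hdα Z)
  simp only [coordMV_self, coordOne_self] at h3
  rw [hZ, h3]
  have h2 : ∀ i, D.toFun (α i) x (Ω.flat x Z) = (fderiv ℝ (coordOne (chartAt (Model n) x) (α i))
      (chartAt (Model n) x x) Z - ContinuousLinearMap.comp (α i x) (C x Z) : Model n →L[ℝ] ℝ) :=
    fun i => by
      ext v
      exact hC x (α i) (hα i) Z v
  simp only [h2]
  exact (congrArg (fun X : Model n => covDerivMV (V := Model n) _ _ _ X _) hZ).trans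
    (covDerivMV_apply_eq_sub (V := Model n) _ _ _ _ _ _)

/-- Every covector at `x` is the value of a global smooth 1-form, namely a cut-off constant form. -/
theorem IsExtension.unique [T2Space P] {a : ℕ} {K : MVField n P a}
    {B B' : (x : P) → (CoT (n := n) x →ₗ[ℝ] MV (n := n) a x)} (hB : D.IsExtension K B)
    (hB' : D.IsExtension K B') : B = B' := by
  funext x
  obtain ⟨φ⟩ : Nonempty (SmoothBumpFunction 𝓘(ℝ, Model n) x) := inferInstance
  ext ξ τ
  have hs : ∀ i, SmoothOneForm (bumpForm φ fun _ => (τ i : Model n →L[ℝ] ℝ)) := fun i =>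
    smoothOneForm_bumpForm φ contDiffOn_const
  have h1 := (hB _ hs x ξ).trans (hB' _ hs x ξ).symm
  have h2 : (fun i => bumpForm φ (fun _ => (τ i : Model n →L[ℝ] ℝ)) x) = τ :=
    funext fun i => bumpForm_self φ _
  rw [h2] at h1
  exact h1

theorem IsExtension.onMV_eq [T2Space P] {a : ℕ} {K : MVField n P a}
    {B : (x : P) → (CoT (n := n) x →ₗ[ℝ] MV (n := n) a x)} (hB : D.IsExtension K B) :
    D.onMV K = B :=
  IsExtension.unique D (Classical.epsilon_spec ⟨B, hB⟩) hB

end ContravariantDerivative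

end Multivectors

/-! ### The curl for the Liouville volume -/

section Curl

variable {m : ℕ} {P : Type*} [TopologicalSpace P] [ChartedSpace (Model (2 * m)) P]

namespace SymplecticForm

variable (Ω : SymplecticForm (2 * m) P)

theorem liouville_ne_zero (x : P) : Ω.liouville x ≠ 0 := by
  have hm : (m.factorial : ℝ)⁻¹ ≠ 0 := inv_ne_zero (Nat.cast_ne_zero.2 m.factorial_ne_zero)
  exact smul_ne_zero hm (wedgePow_ne_zero (V := Model (2 * m)) (Ω.form x) (Ω.nondegenerate x) m
    (by simp))

theorem muFlat_bijective {k p : ℕ} (h : k + p = 2 * m) (x : P) :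
    Function.Bijective (muFlat h Ω.liouville x) := by
  rw [muFlat_eq]
  exact interiorMV_bijective h (modelBasis (2 * m)) proj_modelBasis (Ω.liouville_ne_zero x)

theorem coordForm_liouville (c : OpenPartialHomeomorph P (Model (2 * m))) :
    coordForm c Ω.liouville =
      fun y => (m.factorial : ℝ)⁻¹ • wedgePow (coordForm c Ω.form y) m := by
  funext y
  have := wedgePow_compContinuousLinearMap (V := Model (2 * m)) (Ω.form (c.symm y))
    (dChartSymm c y) m
  exact congrArg (fun η : (Model (2 * m)) [⋀^Fin (2 * m)]→L[ℝ] ℝ => (m.factorial : ℝ)⁻¹ • η) this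

variable [IsManifold 𝓘(ℝ, Model (2 * m)) ∞ P]

/-- If the symplectic form is parallel, the divergence of a multivector field is its curl. -/
theorem curl_apply {k p : ℕ} (h : k + 1 + p = 2 * m) {K : MVField (2 * m) P (k + 1)}
    (hK : SmoothMV K) (x : P) (C : Model (2 * m) →L[ℝ] Model (2 * m) →L[ℝ] Model (2 * m))
    (hC : ∀ X Y, C X Y = C Y X)
    (hΩ : ∀ X Y Z, fderiv ℝ (coordForm (chartAt (Model (2 * m)) x) Ω.form)
        (chartAt (Model (2 * m)) x x) X ![Y, Z] =
      coordForm (chartAt (Model (2 * m)) x) Ω.form (chartAt (Model (2 * m)) x x) ![C X Y, Z] +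
      coordForm (chartAt (Model (2 * m)) x) Ω.form (chartAt (Model (2 * m)) x x) ![Y, C X Z]) :
    curl h Ω.liouville K x = ∑ j, contract (EuclideanSpace.proj j : Model (2 * m) →L[ℝ] ℝ)
      (covDerivMV (fderiv ℝ (coordMV (chartAt (Model (2 * m)) x) K) (chartAt (Model (2 * m)) x x))
        (K x) C (modelBasis (2 * m) j)) := by
  have h' : k + (p + 1) = 2 * m := by omega
  set c := chartAt (Model (2 * m)) x with hc
  have hw := Ω.smooth.differentiableAt x
  have hd := ((differentiable_wedgePow (V := Model (2 * m)) m) _).comp _ hw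
  have hμ : DifferentiableAt ℝ (coordForm c Ω.liouville) (c x) := by
    rw [coordForm_liouville]
    exact hd.const_smul (m.factorial : ℝ)⁻¹
  have hμC : ∀ X, fderiv ℝ (coordForm c Ω.liouville) (c x) X =
      (coordForm c Ω.liouville (c x)).fderivCompContinuousLinearMap (.id ℝ _) (C X) := fun X => by
    have h1 : fderiv ℝ (coordForm c Ω.liouville) (c x) X =
        (m.factorial : ℝ)⁻¹ • fderiv ℝ (fun y => wedgePow (coordForm c Ω.form y) m) (c x) X := by
      rw [coordForm_liouville]
      exact DFunLike.congr_fun (hd.hasFDerivAt.const_smul (m.factorial : ℝ)⁻¹).fderiv X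
    rw [h1, fderiv_wedgePow hw X (C X) (hΩ X) m, coordForm_liouville]
    ext v
    simp [ContinuousAlternatingMap.fderivCompContinuousLinearMap_apply, Finset.mul_sum]
    rfl
  have hev : coordForm c (fun z => muFlat h Ω.liouville z (K z)) =ᶠ[𝓝 (c x)] fun y =>
      interiorMV h (modelBasis (2 * m))
        (fun i => (EuclideanSpace.proj i : Model (2 * m) →L[ℝ] ℝ)) (coordMV c K y)
        (coordForm c Ω.liouville y) := by
    filter_upwards [c.open_target.mem_nhds (mem_chart_target _ x)] with y hy
    exact coordForm_muFlat h Ω.liouville K (chart_mem_atlas _ x) hy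
  have hext := hev.extDeriv_eq.trans (extDeriv_interiorMV h h' (modelBasis (2 * m))
    proj_modelBasis (hK.differentiableAt x) hμ C hC hμC)
  rw [coordMV_self, coordForm_self] at hext
  have hmu : extD (fun z => muFlat h Ω.liouville z (K z)) x = muFlat h' Ω.liouville x
      (∑ j, contract (EuclideanSpace.proj j : Model (2 * m) →L[ℝ] ℝ)
      (covDerivMV (fderiv ℝ (coordMV c K) (c x)) (K x) C (modelBasis (2 * m) j))) := by
    ext v
    refine (extD_apply _ x v).trans ?_
    refine (DFunLike.congr_fun hext v).trans ?_
    rw [muFlat_eq]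
    rfl
  -- Injectivity of `μ♭` makes `invFun` recover the multivector of which `d(μ♭ K)` is the image.
  exact (congrArg (Function.invFun (muFlat h' Ω.liouville x)) hmu).trans
    (Function.leftInverse_invFun (Ω.muFlat_bijective h' x).1 _)

end SymplecticForm

end Curl

end SymplecticCurl

end

/-! ### The curl formula -/

open SymplecticCurl in
theorem theorem5 {m : ℕ} {P : Type*} [TopologicalSpace P] [T2Space P]
    [ChartedSpace (Model (2 * m)) P] [IsManifold 𝓘(ℝ, Model (2 * m)) ∞ P]
    (Ω : SymplecticForm (2 * m) P) (D : ContravariantDerivative Ω)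
    (hD : D.IsPoisson) (hT : D.IsTorsionFree)
    {k p : ℕ} (h : k + 1 + p = 2 * m) :
    (∀ (k' p' : ℕ) (h' : k' + p' = 2 * m) (x : P),
      Function.Bijective (muFlat h' Ω.liouville x)) ∧
    ∀ K : MVField (2 * m) P (k + 1), SmoothMV K →
      (∃! B, D.IsExtension K B) ∧
      ∀ (U : Set P) (e : Fin (2 * m) → (x : P) → T (n := 2 * m) x)
        (θ : Fin (2 * m) → (x : P) → CoT (n := 2 * m) x),
        IsOpen U →
        IsLocalFrameOn 𝓘(ℝ, Model (2 * m)) (Model (2 * m)) ∞ e U →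
        (∀ x ∈ U, ∀ i j, θ i x (e j x) = if i = j then 1 else 0) →
        ∀ x ∈ U, curl h Ω.liouville K x =
          -∑ i, contract (Ω.flat x (e i x)) (D.onMV K x (θ i x)) := by
  choose C hC hΩ hDC using D.exists_christoffel hD hT
  refine ⟨fun k' p' h' x => Ω.muFlat_bijective h' x, fun K hK => ?_⟩
  have hB := D.isExtension_covDerivMV hK C hDC
  refine ⟨⟨_, hB, fun B' hB' => ContravariantDerivative.IsExtension.unique D hB' hB⟩,
    fun U e θ _ _ hθ x hx => ?_⟩
  rw [ContravariantDerivative.IsExtension.onMV_eq D hB]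
  refine (Ω.curl_apply h hK x (C x) (hC x) (hΩ x)).trans ?_
  -- The curl is now a divergence in the standard basis at `x`; it is compared with the frame at
  -- `x`, which is a basis because it has a dual family of the right size.
  obtain ⟨b, hb⟩ := exists_basis_of_dual (V := Model (2 * m)) (by simp) (hθ x hx)
  have hb' : ∀ i j, θ i x (b j) = if i = j then 1 else 0 := fun i j => by
    rw [hb]
    exact hθ x hx i j
  have := sum_contract_dual (V := Model (2 * m)) (Ω.form x) (Ω.flat x) (fun X Y => rfl)
    (modelBasis (2 * m)) proj_modelBasis b hb'
    (covDerivMV (fderiv ℝ (coordMV (chartAt (Model (2 * m)) x) K) (chartAt (Model (2 * m)) x x))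
      (K x) (C x))
  simp only [hb] at this
  refine Eq.trans (neg_neg _).symm (congrArg Neg.neg ?_)
  exact this.symm
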